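/- Let $\mathbb{D}=\{z\in\mathbb{C}:|z|<1\}$. For $f$ analytic on $\mathbb{D}$ and $0\le r<1$ put $$M_p(r,f)=\left(\int_0^{2\pi}|f(re^{i\theta})|^p\,\frac{d\theta}{2\pi}\right)^{1/p}\quad(0<p<\infty),\qquad M_\infty(r,f)=\max_{0\le\theta<2\pi}|f(re^{i\theta})|.$$ For $0<p,q\le\infty$ and $0<\alpha<\infty$ let the mixed norm space $H(p,q,\alpha)$ be the set of all analytic functions $f$ on $\mathbb{D}$ with $\|f\|_{p,q,\alpha}<\infty$, where $$\|f\|_{p,q,\alpha}=\left(\alpha q\int_0^1(1-r)^{\alpha q-1}M_p(r,f)^q\,dr\right)^{1/q}\quad(q<\infty),\qquad \|f\|_{p,\infty,\alpha}=\sup_{0\le r<1}(1-r)^\alpha M_p(r,f).$$ Let $0<p,q,u,v\le\infty$ and $0<\alpha,\beta<\infty$, and use the convention $1/\infty=0$. If $p<u$, then $$H(p,q,\alpha)\subseteq H(u,v,\beta)\iff \alpha+\frac1p<\beta+\frac1u\ \text{ or }\ \left(\alpha+\frac1p=\beta+\frac1u\ \text{ and }\ q\le v\right).$$ -/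

import Mathlib

open MeasureTheory Set
open scoped ENNReal

/-- The integral mean `M_p(r, f)`, with values in `[0, ∞]`:
`((1 / 2π) ∫_0^{2π} |f (r e^{iθ})|^p dθ)^{1/p}` for `0 < p < ∞`, and the supremum (a maximum when
`f` is continuous) of `|f|` on the circle of radius `r` for `p = ∞`. -/
noncomputable def integralMean (p : ℝ≥0∞) (r : ℝ) (f : ℂ → ℂ) : ℝ≥0∞ :=
  if p = ∞ then
    ⨆ θ ∈ Ico (0 : ℝ) (2 * Real.pi), ‖f (r * Complex.exp (θ * Complex.I))‖ₑ
  else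
    (ENNReal.ofReal (1 / (2 * Real.pi)) *
      ∫⁻ θ in Ioc (0 : ℝ) (2 * Real.pi),
        ‖f (r * Complex.exp (θ * Complex.I))‖ₑ ^ p.toReal) ^ (1 / p.toReal)

/-- The mixed norm `‖f‖_{p,q,α}`, with values in `[0, ∞]`:
`(α q ∫_0^1 (1 - r)^{αq - 1} M_p(r, f)^q dr)^{1/q}` for `0 < q < ∞`, and
`sup_{0 ≤ r < 1} (1 - r)^α M_p(r, f)` for `q = ∞`. -/
noncomputable def mixedNorm (p q : ℝ≥0∞) (α : ℝ) (f : ℂ → ℂ) : ℝ≥0∞ :=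
  if q = ∞ then
    ⨆ r ∈ Ico (0 : ℝ) 1, ENNReal.ofReal ((1 - r) ^ α) * integralMean p r f
  else
    (ENNReal.ofReal (α * q.toReal) *
      ∫⁻ r in Ioo (0 : ℝ) 1,
        ENNReal.ofReal ((1 - r) ^ (α * q.toReal - 1)) * integralMean p r f ^ q.toReal) ^
      (1 / q.toReal)

/-- The mixed norm space `H(p, q, α)` of analytic functions on the unit disk with finite mixed
norm. A function on the disk is represented by any extension of it to `ℂ`; membership depends only
on the values in the disk. -/
def mixedNormSpace (p q : ℝ≥0∞) (α : ℝ) : Set (ℂ → ℂ) :=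
  {f | AnalyticOnNhd ℂ f (Metric.ball 0 1) ∧ mixedNorm p q α f < ∞}

/-!
For `f` analytic on the disk and `p > 0`, Jensen's formula gives the sub-mean value property
`|f(c)|^p ≤` mean of `|f|^p` over circles about `c` (`norm_rpow_le_circleAverage`). Two consequences
carry the positive half of the theorem. By the maximum principle, applied to the radial function
`w ↦ M_p(|w|, f)^p`, the means increase with the radius (`integralMean_mono`). Averaging over a disk
of radius `ρ - r` and comparing with an annulus bounds `|f|^p` on the circle of radius `r` by a
constant times `(ρ - r)⁻¹ M_p(ρ, f)^p`, whence the Hardy–Littlewood estimate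
`M_u(r, f) ≤ C (ρ - r)^{1/u - 1/p} M_p(ρ, f)` for `p < u` (`integralMean_le_of_lt`).
With `ρ = (1 + r) / 2` this gives `H(p, q, α) ⊆ H(u, q, β)` on the critical line
`α + 1/p = β + 1/u` (`mixedNorm_lt_top_of_exponent_lt`). Monotonicity of the means gives
`H(u, q, β) ⊆ H(u, ∞, β)`, hence `H(u, q, β) ⊆ H(u, v, β)` for `q ≤ v`, and room in the weight
exponent makes the second exponent irrelevant (`mixedNorm_lt_top_of_lt`).

Conversely, on the critical line with `v < q` the function
`(1 - z)^{-(α + 1/p)} (A - log (1 - z))^{-1/v}` lies in `H(p, q, α)`, as its means of order `p` are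
at most of size `(1 - r)^{-α} (log (1 / (1 - r)))^{-1/v}` as `r → 1`, but not in `H(u, v, β)`, as its
means of order `u` are at least of size `(1 - r)^{-β} (log (1 / (1 - r)))^{-1/v}` and
`∫ dx / (x log (1 / x))` diverges at `0` (`not_subset_of_lt`). If `α + 1/p > β + 1/u`, an inclusion
into `H(u, v, β)` would give one into a space on the critical line with second exponent below `q`,
which has just been excluded.
-/

/-! ### The sub-mean value property from Jensen's formula -/

open Real Filter in
/-- **Sub-mean value property** of `|f|^p`, for every `p > 0`: exponentiate Jensen's formula through
`log t ≤ t - 1` with `t = |f(z)|^p / |f(c)|^p`. -/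
theorem norm_rpow_le_circleAverage {f : ℂ → ℂ} {c : ℂ} {R p : ℝ} (hR : 0 < R)
    (hp : 0 < p) (hf : AnalyticOnNhd ℂ f (Metric.closedBall c R)) :
    ‖f c‖ ^ p ≤ circleAverage (fun z ↦ ‖f z‖ ^ p) c R := by
  by_cases hc : f c = 0
  · rw [hc, norm_zero, zero_rpow hp.ne']
    exact circleAverage_nonneg_of_nonneg fun _ _ ↦ by positivity
  have hG : 0 < ‖f c‖ ^ p := rpow_pos_of_pos (norm_pos_iff.2 hc) p
  set G := ‖f c‖ ^ p with hGdef
  have hf' : AnalyticOnNhd ℂ f (Metric.closedBall c |R|) := by rwa [abs_of_pos hR]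
  have hsub : Metric.sphere c |R| ⊆ Metric.closedBall c |R| := Metric.sphere_subset_closedBall
  -- Jensen's formula bounds `log |f c|` by the mean of `log |f|`
  have hJ : log ‖f c‖ ≤ circleAverage (log ‖f ·‖) c R := by
    rw [hf'.circleAverage_log_norm hR.ne' hc]
    refine le_add_of_nonneg_left (finsum_nonneg fun u ↦ ?_)
    by_cases hu : u ∈ Metric.closedBall c |R|
    · refine mul_nonneg (by exact_mod_cast MeromorphicOn.AnalyticOnNhd.divisor_nonneg hf' u) ?_
      rcases eq_or_ne (c - u) 0 with h0 | h0
      · simp [h0]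
      · apply log_nonneg
        rw [← div_eq_mul_inv, le_div_iff₀ (norm_pos_iff.2 h0), one_mul]
        rw [abs_of_pos hR, Metric.mem_closedBall, dist_comm, dist_eq_norm] at hu
        exact hu
    · simp [hu]
  -- At a zero of `f` the value `log 0 = 0` is too large for the inequality `log t ≤ t - 1`; since
  -- the zeros are discrete, `log |f|` may be replaced there by a value for which it holds.
  set h : ℂ → ℝ := fun z ↦ if f z = 0 then (log G - 1) / p else log ‖f z‖ with hh
  have hfh : (log ‖f ·‖) =ᶠ[codiscreteWithin (Metric.sphere c |R|)] h := by
    have hconn : IsConnected (Metric.closedBall c |R|) :=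
      ⟨⟨c, by simp⟩, (convex_closedBall c |R|).isPreconnected⟩
    have := codiscreteWithin_mono hsub
      (hf'.preimage_zero_mem_codiscreteWithin hc (by simp) hconn)
    filter_upwards [this] with z hz
    have : f z ≠ 0 := by simpa using hz
    simp [hh, this]
  have hhint : CircleIntegrable h c R :=
    (MeromorphicOn.circleIntegrable_log_norm
      (fun z hz ↦ (hf' z (hsub hz)).meromorphicAt)).congr_codiscreteWithin hfh
  have hcont : ContinuousOn (fun z ↦ ‖f z‖ ^ p) (Metric.sphere c |R|) :=
    ((hf'.continuousOn.mono hsub).norm).rpow_const fun _ _ ↦ Or.inr hp.le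
  have hint : CircleIntegrable (fun z ↦ ‖f z‖ ^ p) c R := hcont.circleIntegrable'
  have hpt : ∀ z, h z ≤ (p * G)⁻¹ * ‖f z‖ ^ p + (log G - 1) / p := by
    intro z
    by_cases hz : f z = 0
    · simp [hh, hz, zero_rpow hp.ne']
    · have hz' : 0 < ‖f z‖ := norm_pos_iff.2 hz
      have h1 := log_le_sub_one_of_pos (div_pos (rpow_pos_of_pos hz' p) hG)
      rw [log_div (rpow_pos_of_pos hz' p).ne' hG.ne', log_rpow hz'] at h1
      simp only [hh, hz, if_false]
      rw [mul_inv, ← sub_nonneg]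
      have : p⁻¹ * G⁻¹ * ‖f z‖ ^ p + (log G - 1) / p - log ‖f z‖
        = p⁻¹ * ((‖f z‖ ^ p / G - 1) - (p * log ‖f z‖ - log G)) := by
        field_simp; ring
      rw [this]
      exact mul_nonneg (by positivity) (by linarith)
  have hint2 : CircleIntegrable (fun z ↦ (p * G)⁻¹ * ‖f z‖ ^ p) c R := by
    simpa only [smul_eq_mul] using hint.const_fun_smul (a := (p * G)⁻¹)
  have h3 := circleAverage_mono hhint (hint2.add (circleIntegrable_const ((log G - 1) / p) c R))
    fun x _ ↦ hpt x
  rw [← circleAverage_congr_codiscreteWithin hfh hR.ne', circleAverage_add hint2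
    (circleIntegrable_const _ c R), circleAverage_const] at h3
  have h4 : circleAverage (fun z ↦ (p * G)⁻¹ * ‖f z‖ ^ p) c R
      = (p * G)⁻¹ * circleAverage (fun z ↦ ‖f z‖ ^ p) c R := by
    simpa only [smul_eq_mul] using
      circleAverage_fun_smul (a := (p * G)⁻¹) (f := fun z ↦ ‖f z‖ ^ p) (c := c) (R := R)
  rw [h4] at h3
  have h5 : log G = p * log ‖f c‖ := by rw [hGdef, log_rpow (norm_pos_iff.2 hc)]
  have h6 : (p * G)⁻¹ * circleAverage (fun z ↦ ‖f z‖ ^ p) c R ≥ 1 / p := by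
    have : log ‖f c‖ - (log G - 1) / p = 1 / p := by rw [h5]; field_simp; ring
    linarith
  rw [ge_iff_le, mul_inv, mul_assoc, one_div, inv_mul_eq_div G, le_mul_iff_one_le_right
    (by positivity), one_le_div hG] at h6
  exact h6

/-! ### Circular means increase with the radius -/

/-- The sub-mean value property over circles whose closed disk lies in the open unit disk. -/
def HasSubMean (G : ℂ → ℝ) : Prop :=
  ∀ c R, 0 < R → Metric.closedBall c R ⊆ Metric.ball 0 1 → G c ≤ Real.circleAverage G c R

open Real in
/-- The circular mean over the circle through `w`, parametrized from `w` on. -/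
theorem circleAverage_zero_norm {G : ℂ → ℝ} (w : ℂ) :
    circleAverage G 0 ‖w‖ = (2 * π)⁻¹ * ∫ θ in 0..2 * π, G (w * Complex.exp (θ * Complex.I)) := by
  rw [circleAverage_eq_integral_add (Complex.arg w), smul_eq_mul]
  congr 2 with θ
  congr 1
  conv_rhs => rw [← Complex.norm_mul_exp_arg_mul_I w]
  rw [circleMap, zero_add, mul_assoc, ← Complex.exp_add]
  push_cast
  ring_nf

open Real in
/-- The circular mean about `0` of a function with the sub-mean value property is itself a radial
function with the sub-mean value property. -/
theorem HasSubMean.circleAverage_le {G : ℂ → ℝ} (hG : HasSubMean G)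
    (hcont : ContinuousOn G (Metric.ball 0 1)) {c s : ℝ} (hc : 0 ≤ c) (hs : 0 < s)
    (hcs : c + s < 1) :
    circleAverage G 0 c ≤
      (2 * π)⁻¹ * ∫ t in 0..2 * π, circleAverage G 0 ‖circleMap (c : ℂ) s t‖ := by
  have hmem : ∀ t : ℝ, ‖circleMap (c : ℂ) s t‖ < 1 := fun t ↦ by
    refine lt_of_le_of_lt (norm_add_le _ _) ?_
    rw [← circleMap_zero, norm_circleMap_zero, Complex.norm_real, norm_of_nonneg hc,
      abs_of_pos hs]
    exact hcs
  set K : ℝ → ℝ → ℝ := fun θ t ↦ G (circleMap (c : ℂ) s t * Complex.exp (θ * Complex.I)) with hK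
  have hKc : Continuous (Function.uncurry K) := by
    refine hcont.comp_continuous (f := fun x : ℝ × ℝ ↦
      circleMap (c : ℂ) s x.2 * Complex.exp (x.1 * Complex.I)) (by fun_prop) fun x ↦ ?_
    rw [mem_ball_zero_iff, norm_mul, Complex.norm_exp_ofReal_mul_I, mul_one]
    exact hmem _
  have h1 : ∀ θ : ℝ, G (circleMap 0 c θ) ≤ (2 * π)⁻¹ * ∫ t in 0..2 * π, K θ t := by
    intro θ
    have hsub : Metric.closedBall (circleMap 0 c θ) s ⊆ Metric.ball 0 1 := by
      intro z hz
      rw [mem_ball_zero_iff]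
      rw [mem_closedBall_iff_norm] at hz
      have := norm_le_norm_add_norm_sub (circleMap 0 c θ) z
      rw [norm_circleMap_zero, abs_of_nonneg hc, norm_sub_rev] at this
      linarith
    refine (hG _ s hs hsub).trans_eq ?_
    rw [circleAverage_eq_integral_add θ, smul_eq_mul]
    congr 2 with t
    simp only [hK, circleMap]
    congr 1
    push_cast
    rw [add_mul (t : ℂ), Complex.exp_add]
    ring
  have hcont1 : Continuous fun θ ↦ G (circleMap 0 c θ) := by
    refine hcont.comp_continuous (continuous_circleMap 0 c) fun x ↦ ?_
    rw [mem_ball_zero_iff, norm_circleMap_zero, abs_of_nonneg hc]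
    linarith
  have hcont2 : Continuous fun θ ↦ (2 * π)⁻¹ * ∫ t in 0..2 * π, K θ t :=
    continuous_const.mul
      (intervalIntegral.continuous_parametric_intervalIntegral_of_continuous' hKc _ _)
  have hswap : (∫ θ in 0..2 * π, ∫ t in 0..2 * π, K θ t)
      = ∫ t in 0..2 * π, ∫ θ in 0..2 * π, K θ t := by
    apply intervalIntegral_intervalIntegral_swap
    refine (hKc.continuousOn.integrableOn_compact (K := uIcc 0 (2 * π) ×ˢ uIcc 0 (2 * π))
      (isCompact_uIcc.prod isCompact_uIcc)).mono_set
      (prod_mono uIoc_subset_uIcc uIoc_subset_uIcc)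
  calc circleAverage G 0 c = (2 * π)⁻¹ * ∫ θ in 0..2 * π, G (circleMap 0 c θ) := rfl
    _ ≤ (2 * π)⁻¹ * ∫ θ in 0..2 * π, (2 * π)⁻¹ * ∫ t in 0..2 * π, K θ t := by
      gcongr
      exact intervalIntegral.integral_mono (by positivity) (hcont1.intervalIntegrable _ _)
        (hcont2.intervalIntegrable _ _) h1
    _ = (2 * π)⁻¹ * ∫ t in 0..2 * π, (2 * π)⁻¹ * ∫ θ in 0..2 * π, K θ t := by
      rw [intervalIntegral.integral_const_mul, hswap, intervalIntegral.integral_const_mul]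
    _ = _ := by simp only [circleAverage_zero_norm, hK]

open Real in
/-- Maximum principle: a radial function with the sub-mean value property cannot have an interior
maximum exceeding its boundary value. -/
theorem HasSubMean.monotoneOn_circleAverage {G : ℂ → ℝ} (hG : HasSubMean G)
    (hcont : ContinuousOn G (Metric.ball 0 1)) :
    MonotoneOn (circleAverage G 0) (Ico 0 1) := by
  intro r hr r' hr' hrr'
  by_contra! hlt
  have hA : ContinuousOn (circleAverage G 0) (Ico 0 1) := by
    refine ContinuousOn.circleAverage (hcont.mono fun z hz ↦ ?_) fun x hx ↦ hx.1
    simp only [sub_zero, mem_Ico, mem_ofPred_eq] at hz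
    exact mem_ball_zero_iff.2 hz.2
  have hI : Icc 0 r' ⊆ Ico (0 : ℝ) 1 := fun x hx ↦ ⟨hx.1, hx.2.trans_lt hr'.2⟩
  have hA' := hA.mono hI
  obtain ⟨m, hm, hmax⟩ := isCompact_Icc.exists_isMaxOn ⟨r', hr'.1, le_rfl⟩ hA'
  -- the largest maximum point `c` of the circular mean on `[0, r']`
  have hS : IsCompact (Icc 0 r' ∩ circleAverage G 0 ⁻¹' {circleAverage G 0 m}) :=
    isCompact_Icc.of_isClosed_subset
      (hA'.preimage_isClosed_of_isClosed isClosed_Icc isClosed_singleton) inter_subset_left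
  obtain ⟨c, ⟨hcI, hcm⟩, hcmax⟩ := hS.exists_isGreatest ⟨m, hm, rfl⟩
  have hcm : circleAverage G 0 c = circleAverage G 0 m := hcm
  have hr'm : circleAverage G 0 r' < circleAverage G 0 m :=
    hlt.trans_le (hmax ⟨hr.1, hrr'⟩)
  have hcr' : c < r' := lt_of_le_of_ne hcI.2 fun h ↦ by rw [← h, hcm] at hr'm; exact hr'm.false
  have hs : 0 < r' - c := sub_pos.2 hcr'
  have hbd : ∀ t : ℝ, ‖circleMap (c : ℂ) (r' - c) t‖ ∈ Icc 0 r' := fun t ↦ by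
    refine ⟨norm_nonneg _, (norm_add_le _ _).trans ?_⟩
    rw [← circleMap_zero, norm_circleMap_zero, Complex.norm_real, norm_of_nonneg hcI.1,
      abs_of_pos hs]
    linarith
  have h1 := hG.circleAverage_le hcont hcI.1 hs (by linarith [hr'.2])
  have hcont2 : Continuous fun t ↦ circleAverage G 0 ‖circleMap (c : ℂ) (r' - c) t‖ :=
    hA'.comp_continuous (by fun_prop) hbd
  have h2 : (∫ t in 0..2 * π, circleAverage G 0 ‖circleMap (c : ℂ) (r' - c) t‖)
      < ∫ t in 0..2 * π, circleAverage G 0 m := by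
    refine intervalIntegral.integral_lt_integral_of_continuousOn_of_le_of_exists_lt
      (by positivity) hcont2.continuousOn continuousOn_const (fun t _ ↦ hmax (hbd t))
      ⟨0, ⟨le_rfl, by positivity⟩, ?_⟩
    have : ‖circleMap (c : ℂ) (r' - c) 0‖ = r' := by
      simp only [circleMap, Complex.ofReal_zero, zero_mul, Complex.exp_zero, mul_one]
      rw [← Complex.ofReal_add, Complex.norm_real, norm_of_nonneg (by linarith [hr'.1])]
      ring
    rw [this]
    exact hr'm
  have h3 := mul_lt_mul_of_pos_left h2 (a := (2 * π)⁻¹) (by positivity)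
  rw [intervalIntegral.integral_const, sub_zero, smul_eq_mul, inv_mul_cancel_left₀ (by positivity),
    ← hcm] at h3
  exact (h1.trans_lt h3).false

/-- `|f|^p` has the sub-mean value property when `f` is analytic on the disk. -/
theorem hasSubMean_norm_rpow {f : ℂ → ℂ} (hf : AnalyticOnNhd ℂ f (Metric.ball 0 1)) {p : ℝ}
    (hp : 0 < p) : HasSubMean fun z ↦ ‖f z‖ ^ p :=
  fun _ _ hR hsub ↦ norm_rpow_le_circleAverage hR hp (hf.mono hsub)

theorem continuousOn_norm_rpow {f : ℂ → ℂ} (hf : AnalyticOnNhd ℂ f (Metric.ball 0 1)) {p : ℝ}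
    (hp : 0 < p) : ContinuousOn (fun z ↦ ‖f z‖ ^ p) (Metric.ball 0 1) :=
  hf.continuousOn.norm.rpow_const fun _ _ ↦ Or.inr hp.le

/-! ### Pointwise bounds by circular means -/

open Real in
/-- Integration over the plane in polar coordinates. -/
theorem lintegral_eq_lintegral_circleMap {F : ℂ → ℝ≥0∞} (hF : Measurable F) :
    ∫⁻ w, F w =
      ∫⁻ s in Ioi (0 : ℝ), ENNReal.ofReal s * ∫⁻ θ in Ioo (-π) π, F (circleMap 0 s θ) := by
  have hm : Measurable fun x : ℝ × ℝ ↦ F (circleMap 0 x.1 x.2) :=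
    hF.comp (by fun_prop : Continuous fun x : ℝ × ℝ ↦ circleMap 0 x.1 x.2).measurable
  rw [← Complex.lintegral_comp_polarCoord_symm, polarCoord_target, Measure.volume_eq_prod,
    ← Measure.prod_restrict]
  have hsymm : ∀ x : ℝ × ℝ, Complex.polarCoord.symm x = circleMap 0 x.1 x.2 := fun x ↦ by
    rw [Complex.polarCoord_symm_apply, circleMap_zero, Complex.exp_mul_I]
    push_cast
    rfl
  simp only [hsymm, smul_eq_mul]
  rw [lintegral_prod _ (by fun_prop)]
  refine lintegral_congr fun s ↦ ?_
  exact lintegral_const_mul' _ _ ENNReal.ofReal_ne_top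

open Real in
theorem lintegral_circleMap_eq {G : ℂ → ℝ} {c : ℂ} {s : ℝ} (hG : ∀ z, 0 ≤ G z)
    (hcont : Continuous fun θ ↦ G (circleMap c s θ)) (a : ℝ) :
    ∫⁻ θ in Ioc a (a + 2 * π), ENNReal.ofReal (G (circleMap c s θ))
      = ENNReal.ofReal (2 * π * circleAverage G c s) := by
  have hper : Function.Periodic (fun θ ↦ G (circleMap c s θ)) (2 * π) :=
    fun θ ↦ by simp [periodic_circleMap c s θ]
  have h := hper.intervalIntegral_add_eq a 0
  rw [← ofReal_integral_eq_lintegral_ofReal _ (ae_of_all _ fun _ ↦ hG _),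
    ← intervalIntegral.integral_of_le (by linarith [pi_pos]), h, zero_add, circleAverage_def,
    smul_eq_mul, mul_inv_cancel_left₀ (by positivity)]
  exact (intervalIntegrable_iff_integrableOn_Ioc_of_le (by linarith [pi_pos])).1
    (hcont.intervalIntegrable _ _)

open Real in
/-- A nonnegative function with the sub-mean value property is bounded on a circle by its mean over
a larger circle: average over the disk about `z` of radius `ρ - |z|`, which lies in an annulus of
width at most `2 (ρ - |z|)`. -/
theorem HasSubMean.le_circleAverage {G : ℂ → ℝ} (hG : HasSubMean G) (hG0 : ∀ z, 0 ≤ G z)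
    (hcont : ContinuousOn G (Metric.ball 0 1)) {z : ℂ} {ρ : ℝ} (hz : ‖z‖ < ρ) (hρ : ρ < 1) :
    G z ≤ 4 / (ρ - ‖z‖) * circleAverage G 0 ρ := by
  set δ := ρ - ‖z‖ with hδ
  have hδ0 : 0 < δ := sub_pos.2 hz
  have hρ0 : 0 < ρ := (norm_nonneg z).trans_lt hz
  have hA0 : 0 ≤ circleAverage G 0 ρ := circleAverage_nonneg_of_nonneg fun _ _ ↦ hG0 _
  have hcirc : ∀ c s, 0 ≤ s → ‖c‖ + s < 1 → Continuous fun θ ↦ G (circleMap c s θ) := by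
    intro c s hs hcs
    refine hcont.comp_continuous (continuous_circleMap c s) fun x ↦ ?_
    rw [mem_ball_zero_iff]
    refine (norm_add_le _ _).trans_lt ?_
    rwa [← circleMap_zero, norm_circleMap_zero, abs_of_nonneg hs]
  have hIoo : ∀ F : ℝ → ℝ≥0∞, ∫⁻ θ in Ioo (-π) π, F θ = ∫⁻ θ in Ioc (-π) (-π + 2 * π), F θ := by
    intro F
    rw [show -π + 2 * π = π by ring, restrict_Ioo_eq_restrict_Ioc]
  set g : ℂ → ℝ≥0∞ := (Metric.ball z δ).indicator fun w ↦ ENNReal.ofReal (G w) with hg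
  have hball : Metric.ball z δ ⊆ Metric.ball 0 1 :=
    Metric.ball_subset_ball' (by rw [dist_zero_right]; linarith)
  have hgm : Measurable g := by
    classical
    have : g = (Metric.ball z δ).piecewise (fun w ↦ ENNReal.ofReal (G w)) fun _ ↦ 0 := by
      rw [hg, ← piecewise_eq_indicator]; rfl
    rw [this]
    exact ((ENNReal.continuous_ofReal.comp_continuousOn hcont).mono hball).measurable_piecewise
      continuousOn_const measurableSet_ball
  -- the integral over the disk is at least its area times the value at the centre
  have hlow : ENNReal.ofReal (π * δ ^ 2 * G z) ≤ ∫⁻ w, g w := by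
    rw [← lintegral_add_left_eq_self g z, lintegral_eq_lintegral_circleMap
      (F := fun w ↦ g (z + w)) (by fun_prop)]
    have h1 : ∀ s ∈ Ioo 0 δ, ENNReal.ofReal (s * (2 * π * G z)) ≤
        ENNReal.ofReal s * ∫⁻ θ in Ioo (-π) π, g (z + circleMap 0 s θ) := by
      intro s hs
      have hsub : Metric.closedBall z s ⊆ Metric.ball 0 1 :=
        (Metric.closedBall_subset_ball hs.2).trans hball
      have h2 : ∀ θ, g (z + circleMap 0 s θ) = ENNReal.ofReal (G (circleMap z s θ)) := by
        intro θ
        rw [← circleMap_sub_center z, add_sub_cancel, hg, indicator_of_mem]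
        rw [mem_ball_iff_norm, circleMap_sub_center, norm_circleMap_zero, abs_of_pos hs.1]
        exact hs.2
      simp only [h2]
      rw [hIoo, lintegral_circleMap_eq hG0 (hcirc z s hs.1.le (by linarith [hs.2])),
        ENNReal.ofReal_mul hs.1.le]
      gcongr
      exact hG z s hs.1 hsub
    refine le_trans ?_ (lintegral_mono_set (fun s (hs : s ∈ Ioo 0 δ) ↦ hs.1))
    refine le_trans ?_ (setLIntegral_mono' measurableSet_Ioo h1)
    rw [restrict_Ioo_eq_restrict_Ioc, ← ofReal_integral_eq_lintegral_ofReal,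
      ← intervalIntegral.integral_of_le hδ0.le, intervalIntegral.integral_mul_const, integral_id]
    · apply ENNReal.ofReal_le_ofReal; apply le_of_eq; ring
    · exact (by fun_prop : Continuous fun s ↦ s * (2 * π * G z)).integrableOn_Ioc
    · filter_upwards [ae_restrict_mem measurableSet_Ioc] with s hs
      have := hG0 z
      have := hs.1.le
      positivity
  -- the disk is contained in the annulus `|z| - δ < |w| < ρ`
  have hup : ∫⁻ w, g w ≤ ENNReal.ofReal (2 * δ * (2 * π * circleAverage G 0 ρ)) := by
    rw [lintegral_eq_lintegral_circleMap hgm]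
    have h1 : ∀ s ∈ Ioi (0 : ℝ), ENNReal.ofReal s * ∫⁻ θ in Ioo (-π) π, g (circleMap 0 s θ) ≤
        (Ioo (‖z‖ - δ) ρ).indicator
          (fun _ ↦ ENNReal.ofReal (2 * π * circleAverage G 0 ρ)) s := by
      intro s (hs : 0 < s)
      by_cases hmem : s ∈ Ioo (‖z‖ - δ) ρ
      · rw [indicator_of_mem hmem]
        calc _ ≤ 1 * ∫⁻ θ in Ioo (-π) π, ENNReal.ofReal (G (circleMap 0 s θ)) := by
              gcongr
              · exact ENNReal.ofReal_le_one.2 (hmem.2.trans hρ).le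
              · exact indicator_le_self _ _ _
          _ = ENNReal.ofReal (2 * π * circleAverage G 0 s) := by
              rw [one_mul, hIoo, lintegral_circleMap_eq hG0 (hcirc 0 s hs.le
                (by rw [norm_zero]; linarith [hmem.2]))]
          _ ≤ _ := by
              gcongr
              exact hG.monotoneOn_circleAverage hcont ⟨hs.le, hmem.2.trans hρ⟩ ⟨hρ0.le, hρ⟩
                hmem.2.le
      · rw [indicator_of_notMem hmem]
        have : ∀ θ, g (circleMap 0 s θ) = 0 := by
          intro θ
          refine indicator_of_notMem (fun hw ↦ hmem ?_) _
          rw [mem_ball_iff_norm] at hw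
          have h3 := (abs_norm_sub_norm_le _ _).trans_lt hw
          rw [norm_circleMap_zero, abs_of_pos hs, abs_lt] at h3
          exact ⟨by linarith [h3.1], by linarith [h3.2]⟩
        simp [this]
    refine (setLIntegral_mono' measurableSet_Ioi h1).trans ?_
    refine (setLIntegral_le_lintegral _ _).trans ?_
    rw [lintegral_indicator measurableSet_Ioo, setLIntegral_const, Real.volume_Ioo,
      mul_comm, ← ENNReal.ofReal_mul (by linarith)]
    apply ENNReal.ofReal_le_ofReal; apply le_of_eq; rw [hδ]; ring
  have h := hlow.trans hup
  rw [ENNReal.ofReal_le_ofReal_iff (by positivity)] at h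
  rw [div_mul_eq_mul_div, le_div_iff₀ hδ0]
  refine le_of_mul_le_mul_left ?_ (by positivity : 0 < π * δ)
  linarith

/-! ### Integral means -/

theorem continuous_circleMap_norm_rpow {f : ℂ → ℂ} (hf : AnalyticOnNhd ℂ f (Metric.ball 0 1))
    {p r : ℝ} (hp : 0 < p) (hr : r ∈ Ico (0 : ℝ) 1) :
    Continuous fun θ ↦ ‖f (circleMap 0 r θ)‖ ^ p := by
  refine (continuousOn_norm_rpow hf hp).comp_continuous (continuous_circleMap 0 r) fun θ ↦ ?_
  rw [mem_ball_zero_iff, norm_circleMap_zero, abs_of_nonneg hr.1]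
  exact hr.2

open Real in
theorem integralMean_eq_circleAverage {p : ℝ≥0∞} (hp : p ≠ 0) (hp' : p ≠ ∞) {f : ℂ → ℂ}
    (hf : AnalyticOnNhd ℂ f (Metric.ball 0 1)) {r : ℝ} (hr : r ∈ Ico (0 : ℝ) 1) :
    integralMean p r f
      = ENNReal.ofReal (circleAverage (fun z ↦ ‖f z‖ ^ p.toReal) 0 r ^ (1 / p.toReal)) := by
  have hp0 : 0 < p.toReal := ENNReal.toReal_pos hp hp'
  rw [integralMean, if_neg hp', ← ENNReal.ofReal_rpow_of_nonneg
    (circleAverage_nonneg_of_nonneg fun _ _ ↦ by positivity) (by positivity)]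
  have h := lintegral_circleMap_eq (G := fun z ↦ ‖f z‖ ^ p.toReal) (fun _ ↦ by positivity)
    (continuous_circleMap_norm_rpow hf hp0 hr) 0
  have h2 : ∀ θ : ℝ, ‖f (r * Complex.exp (θ * Complex.I))‖ₑ ^ p.toReal
      = ENNReal.ofReal (‖f (circleMap 0 r θ)‖ ^ p.toReal) := by
    intro θ
    rw [← ofReal_norm, ENNReal.ofReal_rpow_of_nonneg (norm_nonneg _) hp0.le, circleMap_zero]
  simp only [h2]
  rw [zero_add] at h
  rw [h, ← ENNReal.ofReal_mul (by positivity), one_div, inv_mul_cancel_left₀ (by positivity)]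

open Real in
theorem enorm_le_integralMean_top {f : ℂ → ℂ} (z : ℂ) : ‖f z‖ₑ ≤ integralMean ∞ ‖z‖ f := by
  rw [integralMean, if_pos rfl]
  set θ := toIcoMod two_pi_pos 0 (Complex.arg z) with hθ
  have hmem : θ ∈ Ico 0 (2 * π) := by
    simpa using toIcoMod_mem_Ico two_pi_pos 0 (Complex.arg z)
  have hexp : (‖z‖ : ℂ) * Complex.exp (θ * Complex.I) = z := by
    have : circleMap 0 ‖z‖ θ = circleMap 0 ‖z‖ (Complex.arg z) := by
      rw [hθ, ← self_sub_toIcoDiv_zsmul, (periodic_circleMap 0 ‖z‖).sub_zsmul_eq]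
    rw [circleMap_zero, circleMap_zero, Complex.norm_mul_exp_arg_mul_I] at this
    exact this
  calc ‖f z‖ₑ = ‖f (‖z‖ * Complex.exp (θ * Complex.I))‖ₑ := by rw [hexp]
    _ ≤ _ := le_iSup₂ (f := fun (θ : ℝ) (_ : θ ∈ Ico (0 : ℝ) (2 * π)) ↦
      ‖f (‖z‖ * Complex.exp (θ * Complex.I))‖ₑ) θ hmem

theorem integralMean_top_le {f : ℂ → ℂ} {r : ℝ} (hr : 0 ≤ r) {C : ℝ≥0∞}
    (h : ∀ z, ‖z‖ = r → ‖f z‖ₑ ≤ C) : integralMean ∞ r f ≤ C := by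
  rw [integralMean, if_pos rfl]
  refine iSup₂_le fun θ _ ↦ h _ ?_
  rw [norm_mul, Complex.norm_exp_ofReal_mul_I, mul_one, Complex.norm_real, Real.norm_of_nonneg hr]

/-- The integral means of an analytic function increase with the radius. -/
theorem integralMean_mono {p : ℝ≥0∞} (hp : p ≠ 0) {f : ℂ → ℂ}
    (hf : AnalyticOnNhd ℂ f (Metric.ball 0 1)) {r ρ : ℝ} (hr : 0 ≤ r) (hrρ : r ≤ ρ) (hρ : ρ < 1) :
    integralMean p r f ≤ integralMean p ρ f := by
  rcases eq_or_ne p ∞ with rfl | hp'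
  · rcases hrρ.eq_or_lt with rfl | hlt
    · rfl
    refine integralMean_top_le hr fun z hz ↦ ?_
    rcases eq_or_ne (integralMean ∞ ρ f) ∞ with htop | htop
    · simp [htop]
    have hsub : Metric.closedBall (0 : ℂ) ρ ⊆ Metric.ball 0 1 := Metric.closedBall_subset_ball hρ
    have hd : DiffContOnCl ℂ f (Metric.ball 0 ρ) :=
      (hf.differentiableOn.mono hsub).diffContOnCl_ball subset_rfl
    have := Complex.norm_le_of_forall_mem_frontier_norm_le Metric.isBounded_ball hd
      (C := (integralMean ∞ ρ f).toReal) (fun w hw ↦ ?_) (z := z)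
      (subset_closure (by rw [mem_ball_zero_iff, hz]; exact hlt))
    · rw [← ofReal_norm]
      exact ENNReal.ofReal_le_of_le_toReal this
    · have hw' := Metric.frontier_ball_subset_sphere hw
      rw [mem_sphere_zero_iff_norm] at hw'
      have := enorm_le_integralMean_top (f := f) w
      rw [hw', ← ofReal_norm] at this
      exact (ENNReal.ofReal_le_iff_le_toReal htop).1 this
  · have hp0 : 0 < p.toReal := ENNReal.toReal_pos hp hp'
    rw [integralMean_eq_circleAverage hp hp' hf ⟨hr, hrρ.trans_lt hρ⟩,
      integralMean_eq_circleAverage hp hp' hf ⟨hr.trans hrρ, hρ⟩]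
    gcongr
    · exact Real.circleAverage_nonneg_of_nonneg fun _ _ ↦ by positivity
    · exact (hasSubMean_norm_rpow hf hp0).monotoneOn_circleAverage (continuousOn_norm_rpow hf hp0)
        ⟨hr, hrρ.trans_lt hρ⟩ ⟨hr.trans hrρ, hρ⟩ hrρ

open Real in
/-- **Hardy–Littlewood**: an increase of the exponent costs a power of the gap between the radii. -/
theorem integralMean_le_of_lt {p u : ℝ≥0∞} (hp : p ≠ 0) (hpu : p < u) {f : ℂ → ℂ}
    (hf : AnalyticOnNhd ℂ f (Metric.ball 0 1)) {r ρ : ℝ} (hr : 0 ≤ r) (hrρ : r < ρ) (hρ : ρ < 1) :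
    integralMean u r f ≤
      ENNReal.ofReal ((4 / (ρ - r)) ^ ((1 / p).toReal - (1 / u).toReal)) * integralMean p ρ f := by
  have hp' : p ≠ ∞ := hpu.ne_top
  have hp0 : 0 < p.toReal := ENNReal.toReal_pos hp hp'
  have hρ0 : 0 ≤ ρ := hr.trans hrρ.le
  have hgap : 0 < 4 / (ρ - r) := div_pos (by norm_num) (sub_pos.2 hrρ)
  set P := p.toReal with hP
  set A := circleAverage (fun z ↦ ‖f z‖ ^ P) 0 ρ with hA
  have hA0 : 0 ≤ A := circleAverage_nonneg_of_nonneg fun _ _ ↦ by positivity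
  have hsm := hasSubMean_norm_rpow hf hp0
  have hc := continuousOn_norm_rpow hf hp0
  have hpt : ∀ z, ‖z‖ = r → ‖f z‖ ^ P ≤ 4 / (ρ - r) * A := by
    rintro z rfl
    exact hsm.le_circleAverage (fun _ ↦ by positivity) hc hrρ hρ
  have h1p : (1 / p).toReal = 1 / P := by rw [ENNReal.toReal_div, ENNReal.toReal_one]
  rw [integralMean_eq_circleAverage hp hp' hf ⟨hρ0, hρ⟩, ← ENNReal.ofReal_mul (by positivity), h1p]
  rcases eq_or_ne u ∞ with rfl | hu
  · refine integralMean_top_le hr fun z hz ↦ ?_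
    rw [← ofReal_norm]
    apply ENNReal.ofReal_le_ofReal
    rw [ENNReal.div_top, ENNReal.toReal_zero, sub_zero, ← mul_rpow hgap.le hA0]
    calc ‖f z‖ = (‖f z‖ ^ P) ^ (1 / P) := by
          rw [one_div, rpow_rpow_inv (norm_nonneg _) hp0.ne']
      _ ≤ _ := by gcongr; exact hpt z hz
  · have hu0 : u ≠ 0 := (pos_of_gt hpu).ne'
    have hU0 : 0 < u.toReal := ENNReal.toReal_pos hu0 hu
    have hPU : P < u.toReal := (ENNReal.toReal_lt_toReal hp' hu).2 hpu
    rw [integralMean_eq_circleAverage hu0 hu hf ⟨hr, hrρ.trans hρ⟩, ENNReal.toReal_div,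
      ENNReal.toReal_one]
    set U := u.toReal with hU
    apply ENNReal.ofReal_le_ofReal
    have hmem : r ∈ Ico (0 : ℝ) 1 := ⟨hr, hrρ.trans hρ⟩
    have hUm : circleAverage (fun z ↦ ‖f z‖ ^ U) 0 r ≤
        (4 / (ρ - r) * A) ^ ((U - P) / P) * A := by
      have hci : CircleIntegrable (fun z ↦ ‖f z‖ ^ P) 0 r :=
        (continuous_circleMap_norm_rpow hf hp0 hmem).intervalIntegrable _ _
      have h1 : circleAverage (fun z ↦ ‖f z‖ ^ U) 0 r ≤
          circleAverage (fun z ↦ (4 / (ρ - r) * A) ^ ((U - P) / P) • ‖f z‖ ^ P) 0 r := by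
        refine circleAverage_mono ((continuous_circleMap_norm_rpow hf hU0 hmem).intervalIntegrable
          _ _) hci.const_fun_smul fun z hz ↦ ?_
        rw [mem_sphere_zero_iff_norm, abs_of_nonneg hr] at hz
        have h2 : ‖f z‖ ^ U = (‖f z‖ ^ P) ^ ((U - P) / P) * ‖f z‖ ^ P := by
          rw [← rpow_mul (norm_nonneg _), mul_div_cancel₀ _ hp0.ne', ← rpow_add_of_nonneg
            (norm_nonneg _) (by linarith) hp0.le, sub_add_cancel]
        rw [h2, smul_eq_mul]
        have : 0 ≤ (U - P) / P := div_nonneg (by linarith) hp0.le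
        gcongr
        exact hpt z hz
      refine h1.trans ?_
      rw [circleAverage_fun_smul, smul_eq_mul]
      gcongr
      exact hsm.monotoneOn_circleAverage hc hmem ⟨hρ0, hρ⟩ hrρ.le
    calc circleAverage (fun z ↦ ‖f z‖ ^ U) 0 r ^ (1 / U)
        ≤ ((4 / (ρ - r) * A) ^ ((U - P) / P) * A) ^ (1 / U) := by
          gcongr
          exact circleAverage_nonneg_of_nonneg fun _ _ ↦ by positivity
      _ = (4 / (ρ - r)) ^ (1 / P - 1 / U) * (A ^ (1 / P - 1 / U) * A ^ (1 / U)) := by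
          have he : (U - P) / P * (1 / U) = 1 / P - 1 / U := by field_simp
          rw [mul_rpow (by positivity) hA0, ← rpow_mul (by positivity), he,
            mul_rpow hgap.le hA0, mul_assoc]
      _ = _ := by
          have : 1 / U ≤ 1 / P := one_div_le_one_div_of_le hp0 hPU.le
          rw [← rpow_add_of_nonneg hA0 (by linarith) (by positivity), sub_add_cancel]

/-! ### Inclusions between mixed norm spaces -/

theorem lintegral_one_sub_rpow {a r : ℝ} (ha : 0 < a) (hr : r ≤ 1) :
    ∫⁻ t in Ioo r 1, ENNReal.ofReal ((1 - t) ^ (a - 1)) = ENNReal.ofReal ((1 - r) ^ a / a) := by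
  have hi : IntervalIntegrable (fun t : ℝ ↦ (1 - t) ^ (a - 1)) volume r 1 := by
    have := (intervalIntegral.intervalIntegrable_rpow' (a := 1 - r) (b := 0) (r := a - 1)
      (by linarith)).comp_sub_left 1
    simpa using this
  rw [restrict_Ioo_eq_restrict_Ioc, ← ofReal_integral_eq_lintegral_ofReal,
    ← intervalIntegral.integral_of_le hr,
    intervalIntegral.integral_comp_sub_left (fun x ↦ x ^ (a - 1)), sub_self,
    integral_rpow (Or.inl (by linarith)), sub_add_cancel, Real.zero_rpow ha.ne', sub_zero]
  · exact (intervalIntegrable_iff_integrableOn_Ioc_of_le hr).1 hi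
  · filter_upwards [ae_restrict_mem measurableSet_Ioc] with t ht
    exact Real.rpow_nonneg (by linarith [ht.2]) _

theorem mixedNorm_lt_top_iff {p q : ℝ≥0∞} {α : ℝ} (hq : q ≠ 0) (hq' : q ≠ ∞) (hα : 0 < α)
    {f : ℂ → ℂ} :
    mixedNorm p q α f < ∞ ↔
      ∫⁻ r in Ioo (0 : ℝ) 1, ENNReal.ofReal ((1 - r) ^ (α * q.toReal - 1)) *
        integralMean p r f ^ q.toReal < ∞ := by
  have hq0 : 0 < q.toReal := ENNReal.toReal_pos hq hq'
  rw [mixedNorm, if_neg hq', ENNReal.rpow_lt_top_iff_of_pos (by positivity)]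
  constructor
  · intro h
    exact ENNReal.lt_top_of_mul_ne_top_right h.ne (by simpa using mul_pos hα hq0)
  · exact fun h ↦ ENNReal.mul_lt_top ENNReal.ofReal_lt_top h

theorem le_mixedNorm_top {p : ℝ≥0∞} {α r : ℝ} {f : ℂ → ℂ} (hr : r ∈ Ico (0 : ℝ) 1) :
    ENNReal.ofReal ((1 - r) ^ α) * integralMean p r f ≤ mixedNorm p ∞ α f := by
  rw [mixedNorm, if_pos rfl]
  exact le_iSup₂ (f := fun (r : ℝ) (_ : r ∈ Ico (0 : ℝ) 1) ↦
    ENNReal.ofReal ((1 - r) ^ α) * integralMean p r f) r hr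

theorem mixedNorm_top_le {p : ℝ≥0∞} {α : ℝ} {f : ℂ → ℂ} {C : ℝ≥0∞}
    (h : ∀ r ∈ Ico (0 : ℝ) 1, ENNReal.ofReal ((1 - r) ^ α) * integralMean p r f ≤ C) :
    mixedNorm p ∞ α f ≤ C := by
  rw [mixedNorm, if_pos rfl]
  exact iSup₂_le h

/-- Since the means increase, the value at `r` is controlled by the part of the norm integral
over `(r, 1)`. -/
theorem mixedNorm_top_lt_top {p q : ℝ≥0∞} {α : ℝ} (hp : p ≠ 0) (hq : q ≠ 0) (hα : 0 < α)
    {f : ℂ → ℂ} (hf : AnalyticOnNhd ℂ f (Metric.ball 0 1)) (h : mixedNorm p q α f < ∞) :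
    mixedNorm p ∞ α f < ∞ := by
  rcases eq_or_ne q ∞ with rfl | hq'
  · exact h
  have hq0 : 0 < q.toReal := ENNReal.toReal_pos hq hq'
  have ha : 0 < α * q.toReal := mul_pos hα hq0
  rw [mixedNorm_lt_top_iff hq hq' hα] at h
  set I := ∫⁻ r in Ioo (0 : ℝ) 1, ENNReal.ofReal ((1 - r) ^ (α * q.toReal - 1)) *
        integralMean p r f ^ q.toReal with hI
  have hbd : mixedNorm p ∞ α f ≤ (ENNReal.ofReal (α * q.toReal) * I) ^ (1 / q.toReal) := by
    refine mixedNorm_top_le fun r hr ↦ ?_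
    have h1r : 0 ≤ 1 - r := by linarith [hr.2]
    rw [one_div, ENNReal.le_rpow_inv_iff hq0, ENNReal.mul_rpow_of_nonneg _ _ hq0.le,
      ENNReal.ofReal_rpow_of_nonneg (by positivity) hq0.le, ← Real.rpow_mul h1r]
    have h1 : ENNReal.ofReal ((1 - r) ^ (α * q.toReal) / (α * q.toReal)) *
        integralMean p r f ^ q.toReal ≤ I := by
      rw [← lintegral_one_sub_rpow ha hr.2.le]
      refine (lintegral_mul_const_le _ _).trans ?_
      refine (setLIntegral_mono' measurableSet_Ioo fun t ht ↦ ?_).trans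
        (lintegral_mono_set (Ioo_subset_Ioo_left hr.1))
      gcongr
      exact integralMean_mono hp hf hr.1 ht.1.le ht.2
    refine le_trans (le_of_eq ?_) (mul_le_mul_right h1 _)
    rw [← mul_assoc, ← ENNReal.ofReal_mul ha.le, mul_div_cancel₀ _ ha.ne']
  refine hbd.trans_lt ?_
  rw [ENNReal.rpow_lt_top_iff_of_pos (by positivity)]
  exact ENNReal.mul_lt_top ENNReal.ofReal_lt_top h

/-- The spaces increase with the second exponent: split off the factor
`((1 - r)^α M_p(r, f))^{v - q}`, which is bounded. -/
theorem mixedNorm_lt_top_of_le {p q v : ℝ≥0∞} {α : ℝ} (hp : p ≠ 0) (hq : q ≠ 0) (hα : 0 < α)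
    (hqv : q ≤ v) {f : ℂ → ℂ} (hf : AnalyticOnNhd ℂ f (Metric.ball 0 1))
    (h : mixedNorm p q α f < ∞) : mixedNorm p v α f < ∞ := by
  have hS := mixedNorm_top_lt_top hp hq hα hf h
  rcases eq_or_ne v ∞ with rfl | hv'
  · exact hS
  have hq' : q ≠ ∞ := (hqv.trans_lt hv'.lt_top).ne
  have hv : v ≠ 0 := (hq.bot_lt.trans_le hqv).ne'
  have hq0 : 0 < q.toReal := ENNReal.toReal_pos hq hq'
  have hqv' : q.toReal ≤ v.toReal := ENNReal.toReal_mono hv' hqv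
  rw [mixedNorm_lt_top_iff hq hq' hα] at h
  rw [mixedNorm_lt_top_iff hv hv' hα]
  have hC : mixedNorm p ∞ α f ^ (v.toReal - q.toReal) < ∞ :=
    ENNReal.rpow_lt_top_of_nonneg (by linarith) hS.ne
  refine lt_of_le_of_lt (b := ∫⁻ r in Ioo (0 : ℝ) 1, mixedNorm p ∞ α f ^ (v.toReal - q.toReal) *
    (ENNReal.ofReal ((1 - r) ^ (α * q.toReal - 1)) * integralMean p r f ^ q.toReal)) ?_ ?_
  · refine setLIntegral_mono' measurableSet_Ioo fun r hr ↦ ?_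
    have h1r : 0 < 1 - r := by linarith [hr.2]
    have h1 : (ENNReal.ofReal ((1 - r) ^ α) * integralMean p r f) ^ (v.toReal - q.toReal) ≤
        mixedNorm p ∞ α f ^ (v.toReal - q.toReal) :=
      ENNReal.rpow_le_rpow (le_mixedNorm_top ⟨hr.1.le, hr.2⟩) (by linarith)
    refine le_trans (le_of_eq ?_) (mul_le_mul_left h1 _)
    rw [ENNReal.mul_rpow_of_nonneg _ _ (by linarith), ENNReal.ofReal_rpow_of_pos (by positivity),
      ← Real.rpow_mul h1r.le, mul_mul_mul_comm, ← ENNReal.ofReal_mul (by positivity),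
      ← Real.rpow_add h1r, ← ENNReal.rpow_add_of_nonneg _ _ (by linarith) hq0.le, sub_add_cancel]
    ring_nf
  · rw [lintegral_const_mul' _ _ hC.ne]
    exact ENNReal.mul_lt_top hC h

/-- A larger weight exponent absorbs any change of the second exponent. -/
theorem mixedNorm_lt_top_of_lt {p v : ℝ≥0∞} {α β : ℝ} (hv : v ≠ 0) (hβ : 0 < β) (hαβ : α < β)
    {f : ℂ → ℂ} (h : mixedNorm p ∞ α f < ∞) : mixedNorm p v β f < ∞ := by
  rcases eq_or_ne v ∞ with rfl | hv'
  · refine lt_of_le_of_lt (mixedNorm_top_le fun r hr ↦ ?_) h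
    refine le_trans ?_ (le_mixedNorm_top hr)
    gcongr ENNReal.ofReal ?_ * _
    exact Real.rpow_le_rpow_of_exponent_ge (by linarith [hr.2]) (by linarith [hr.1]) hαβ.le
  have hv0 : 0 < v.toReal := ENNReal.toReal_pos hv hv'
  rw [mixedNorm_lt_top_iff hv hv' hβ]
  have hC : mixedNorm p ∞ α f ^ v.toReal < ∞ := ENNReal.rpow_lt_top_of_nonneg hv0.le h.ne
  refine lt_of_le_of_lt (b := ∫⁻ r in Ioo (0 : ℝ) 1, mixedNorm p ∞ α f ^ v.toReal *
    ENNReal.ofReal ((1 - r) ^ ((β - α) * v.toReal - 1))) ?_ ?_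
  · refine setLIntegral_mono' measurableSet_Ioo fun r hr ↦ ?_
    have h1r : 0 < 1 - r := by linarith [hr.2]
    have h1 : (ENNReal.ofReal ((1 - r) ^ α) * integralMean p r f) ^ v.toReal ≤
        mixedNorm p ∞ α f ^ v.toReal :=
      ENNReal.rpow_le_rpow (le_mixedNorm_top ⟨hr.1.le, hr.2⟩) hv0.le
    refine le_trans (le_of_eq ?_) (mul_le_mul_left h1 _)
    rw [ENNReal.mul_rpow_of_nonneg _ _ hv0.le, ENNReal.ofReal_rpow_of_pos (by positivity),
      ← Real.rpow_mul h1r.le, mul_right_comm, ← ENNReal.ofReal_mul (by positivity),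
      ← Real.rpow_add h1r]
    ring_nf
  · rw [lintegral_const_mul' _ _ hC.ne,
      lintegral_one_sub_rpow (mul_pos (sub_pos.2 hαβ) hv0) zero_le_one]
    exact ENNReal.mul_lt_top hC ENNReal.ofReal_lt_top

/-- The inclusion with unchanged second exponent: compare the mean of order `u` at `r` with the
mean of order `p` at the midpoint `(1 + r) / 2`. -/
theorem mixedNorm_lt_top_of_exponent_lt {p u q : ℝ≥0∞} {α β : ℝ} (hp : p ≠ 0) (hpu : p < u)
    (hq : q ≠ 0) (hα : 0 < α) (hβ : 0 < β)
    (h : α + (1 / p).toReal = β + (1 / u).toReal) {f : ℂ → ℂ}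
    (hf : AnalyticOnNhd ℂ f (Metric.ball 0 1)) (hfin : mixedNorm p q α f < ∞) :
    mixedNorm u q β f < ∞ := by
  obtain ⟨d, hd⟩ : ∃ d, d = (1 / p).toReal - (1 / u).toReal := ⟨_, rfl⟩
  have hβd : β = α + d := by linarith
  -- the comparison of means with the gap `(1 - r) / 2` written through the larger radius
  have hmean : ∀ r ∈ Ico (0 : ℝ) 1, ENNReal.ofReal ((1 - r) ^ β) * integralMean u r f ≤
      ENNReal.ofReal (4 ^ d * 2 ^ β) *
        (ENNReal.ofReal ((1 - (1 + r) / 2) ^ α) * integralMean p ((1 + r) / 2) f) := by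
    intro r hr
    set x := 1 - (1 + r) / 2 with hx
    have hx0 : 0 < x := by linarith [hr.2]
    have h1 := integralMean_le_of_lt hp hpu hf hr.1 (ρ := (1 + r) / 2) (by linarith [hr.2])
      (by linarith [hr.2])
    refine (mul_le_mul_right h1 _).trans (le_of_eq ?_)
    rw [← mul_assoc, ← mul_assoc, ← ENNReal.ofReal_mul (Real.rpow_nonneg (by linarith) _),
      ← ENNReal.ofReal_mul (by positivity), ← hd, show (1 + r) / 2 - r = x by rw [hx]; ring,
      show 1 - r = 2 * x by rw [hx]; ring, Real.mul_rpow (by norm_num) hx0.le,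
      Real.div_rpow (by norm_num) hx0.le]
    congr 2
    rw [show x ^ β = x ^ α * x ^ d by rw [← Real.rpow_add hx0, hβd]]
    have := (Real.rpow_pos_of_pos hx0 d).ne'
    field_simp
  rcases eq_or_ne q ∞ with rfl | hq'
  · refine lt_of_le_of_lt (b := ENNReal.ofReal (4 ^ d * 2 ^ β) * mixedNorm p ∞ α f)
      (mixedNorm_top_le fun r hr ↦ (hmean r hr).trans ?_)
      (ENNReal.mul_lt_top ENNReal.ofReal_lt_top hfin)
    gcongr
    exact le_mixedNorm_top ⟨by linarith [hr.1], by linarith [hr.2]⟩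
  have hq0 : 0 < q.toReal := ENNReal.toReal_pos hq hq'
  set Q := q.toReal with hQ
  rw [mixedNorm_lt_top_iff hq hq' hα] at hfin
  rw [mixedNorm_lt_top_iff hq hq' hβ]
  set K : ℝ≥0∞ := ENNReal.ofReal (4 ^ d * 2 ^ β) ^ Q with hK
  have hKfin : K < ∞ := ENNReal.rpow_lt_top_of_nonneg hq0.le ENNReal.ofReal_ne_top
  set F : ℝ → ℝ≥0∞ := fun ρ ↦ ENNReal.ofReal ((1 - ρ) ^ (α * Q - 1)) * integralMean p ρ f ^ Q
    with hF
  have himg : (fun r : ℝ ↦ (1 + r) / 2) '' Ioo 0 1 ⊆ Ioo 0 1 := by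
    rintro _ ⟨r, hr, rfl⟩
    exact ⟨by linarith [hr.1], by linarith [hr.2]⟩
  have hcv := lintegral_image_eq_lintegral_abs_deriv_mul (s := Ioo (0 : ℝ) 1)
    (f := fun r : ℝ ↦ (1 + r) / 2) (f' := fun _ ↦ 1 / 2) measurableSet_Ioo
    (fun x _ ↦ (((hasDerivAt_id x).const_add 1).div_const 2).hasDerivWithinAt)
    (fun x _ y _ hxy ↦ by simpa using hxy) F
  have h2 : ∫⁻ r in Ioo (0 : ℝ) 1, ENNReal.ofReal |1 / 2| * F ((1 + r) / 2) < ∞ := by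
    rw [← hcv]
    exact (lintegral_mono_set himg).trans_lt hfin
  refine lt_of_le_of_lt (b := ∫⁻ r in Ioo (0 : ℝ) 1, K * (ENNReal.ofReal |1 / 2| *
    F ((1 + r) / 2))) ?_ ?_
  · refine setLIntegral_mono' measurableSet_Ioo fun r hr ↦ ?_
    have h1 := ENNReal.rpow_le_rpow (hmean r ⟨hr.1.le, hr.2⟩) hq0.le
    set x := 1 - (1 + r) / 2 with hx
    have hx0 : 0 < x := by linarith [hr.2]
    have h1r : 1 - r = 2 * x := by rw [hx]; ring
    rw [h1r, ENNReal.mul_rpow_of_nonneg _ _ hq0.le, ENNReal.mul_rpow_of_nonneg _ _ hq0.le,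
      ENNReal.mul_rpow_of_nonneg _ _ hq0.le, ENNReal.ofReal_rpow_of_pos (by positivity),
      ENNReal.ofReal_rpow_of_pos (p := Q) (x := x ^ α) (by positivity),
      ← Real.rpow_mul (by positivity),
      ← Real.rpow_mul hx0.le] at h1
    have h3 : ∀ y : ℝ, 0 < y → ∀ a : ℝ, ENNReal.ofReal (y ^ (a - 1)) =
        ENNReal.ofReal y⁻¹ * ENNReal.ofReal (y ^ a) := by
      intro y hy a
      rw [← ENNReal.ofReal_mul (by positivity), Real.rpow_sub_one hy.ne', div_eq_inv_mul]
    rw [h1r, h3 _ (by positivity), mul_assoc]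
    refine (mul_le_mul_right h1 _).trans (le_of_eq ?_)
    simp only [hF]
    rw [← hx, h3 x hx0, mul_inv, ENNReal.ofReal_mul (by norm_num), abs_of_pos (by norm_num),
      one_div]
    ring
  · rw [lintegral_const_mul' _ _ hKfin.ne]
    exact ENNReal.mul_lt_top hKfin h2

/-! ### Logarithmic and power integrals -/

/-- The substitution `y = m - log (1 - r)`. -/
theorem lintegral_inv_one_sub_mul_log (m : ℝ) (H : ℝ → ℝ) :
    ∫⁻ r in Ioo (0 : ℝ) 1, ENNReal.ofReal ((1 - r)⁻¹ * H (m - Real.log (1 - r)))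
      = ∫⁻ y in Ioi m, ENNReal.ofReal (H y) := by
  have himg : (fun y : ℝ ↦ 1 - Real.exp (m - y)) '' Ioi m = Ioo 0 1 := by
    ext r
    constructor
    · rintro ⟨y, hy : m < y, rfl⟩
      have : Real.exp (m - y) < 1 := Real.exp_lt_one_iff.2 (by linarith)
      exact ⟨by linarith, by linarith [Real.exp_pos (m - y)]⟩
    · intro hr
      have h1 : 0 < 1 - r := by linarith [hr.2]
      refine ⟨m - Real.log (1 - r), ?_, ?_⟩
      · have := Real.log_neg h1 (by linarith [hr.1])
        simp only [mem_Ioi]; linarith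
      · simp only [sub_sub_cancel, Real.exp_log h1]
  have hcv := lintegral_image_eq_lintegral_abs_deriv_mul (s := Ioi m)
    (f := fun y : ℝ ↦ 1 - Real.exp (m - y)) (f' := fun y ↦ Real.exp (m - y)) measurableSet_Ioi
    (fun x _ ↦ by
      have := (((hasDerivAt_id x).const_sub m).exp.const_sub 1).hasDerivWithinAt (s := Ioi m)
      simpa using this)
    (fun x _ y _ hxy ↦ by simpa using hxy)
    (fun r ↦ ENNReal.ofReal ((1 - r)⁻¹ * H (m - Real.log (1 - r))))
  rw [himg] at hcv
  rw [hcv]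
  refine lintegral_congr fun y ↦ ?_
  rw [← ENNReal.ofReal_mul (abs_nonneg _), abs_of_pos (Real.exp_pos _), sub_sub_cancel,
    Real.log_exp, sub_sub_cancel, mul_inv_cancel_left₀ (Real.exp_pos _).ne']

theorem lintegral_inv_one_sub_mul_log_rpow_lt_top {m s : ℝ} (hm : 0 < m) (hs : 1 < s) :
    ∫⁻ r in Ioo (0 : ℝ) 1, ENNReal.ofReal ((1 - r)⁻¹ * (m - Real.log (1 - r)) ^ (-s)) < ∞ := by
  rw [lintegral_inv_one_sub_mul_log m fun y ↦ y ^ (-s)]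
  exact (integrableOn_Ioi_rpow_of_lt (by linarith) hm).lintegral_lt_top

theorem lintegral_inv_one_sub_mul_log_inv {m : ℝ} (hm : 0 < m) :
    ∫⁻ r in Ioo (0 : ℝ) 1, ENNReal.ofReal ((1 - r)⁻¹ * (m - Real.log (1 - r))⁻¹) = ∞ := by
  rw [lintegral_inv_one_sub_mul_log m fun y ↦ y⁻¹]
  by_contra h
  refine not_integrableOn_Ioi_inv (a := m) ?_
  refine (lintegral_ofReal_ne_top_iff_integrable measurable_inv.aestronglyMeasurable ?_).1 h
  filter_upwards [ae_restrict_mem measurableSet_Ioi] with y hy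
  exact inv_nonneg.2 (hm.trans hy).le

section Kernel

open Real

theorem one_sub_le_norm_one_sub_mul_exp {r : ℝ} (hr : 0 ≤ r) (θ : ℝ) :
    1 - r ≤ ‖1 - r * Complex.exp (θ * Complex.I)‖ := by
  have := norm_sub_norm_le (1 : ℂ) (r * Complex.exp (θ * Complex.I))
  rwa [norm_one, norm_mul, Complex.norm_exp_ofReal_mul_I, mul_one, Complex.norm_real,
    norm_of_nonneg hr] at this

/-- Here `t` is the angular distance from `θ` to `0` modulo `2π`. -/
theorem add_le_mul_norm_one_sub_mul_exp {r θ t : ℝ} (hr : r ∈ Ico (0 : ℝ) 1) (ht0 : 0 ≤ t)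
    (ht : t ≤ π) (h : θ = t ∨ θ = 2 * π - t) :
    (1 - r) + t ≤ (1 + π) * ‖1 - r * Complex.exp (θ * Complex.I)‖ := by
  set N := ‖1 - r * Complex.exp (θ * Complex.I)‖ with hN
  have h1 : 1 - r ≤ N := one_sub_le_norm_one_sub_mul_exp hr.1 θ
  have hsin : 2 / π * (t / 2) ≤ sin (θ / 2) := by
    have h2 := mul_le_sin (x := t / 2) (by linarith) (by linarith)
    rcases h with rfl | rfl
    · exact h2
    · rwa [show (2 * π - t) / 2 = π - t / 2 by ring, sin_pi_sub]
  have h2 : 2 * (2 / π * (t / 2)) ≤ ‖Complex.exp (θ * Complex.I) - 1‖ := by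
    rw [mul_comm (θ : ℂ), Complex.norm_exp_I_mul_ofReal_sub_one, norm_eq_abs]
    exact (mul_le_mul_of_nonneg_left hsin (by norm_num)).trans (le_abs_self _)
  have h3 : ‖Complex.exp (θ * Complex.I) - 1‖ ≤ (1 - r) + N := by
    have : Complex.exp (θ * Complex.I) - 1
        = ((1 - r : ℝ) : ℂ) * Complex.exp (θ * Complex.I)
          - (1 - r * Complex.exp (θ * Complex.I)) := by push_cast; ring
    rw [this]
    refine (norm_sub_le _ _).trans_eq ?_
    rw [norm_mul, Complex.norm_exp_ofReal_mul_I, mul_one, Complex.norm_real,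
      norm_of_nonneg (by linarith [hr.2])]
  have h4 : t ≤ π * N := by
    have : 2 * (2 / π * (t / 2)) ≤ 2 * N := by linarith
    rw [show 2 * (2 / π * (t / 2)) = 2 * (t / π) by ring] at this
    rw [← div_le_iff₀' pi_pos]
    linarith
  linarith

theorem lintegral_add_rpow_le {x s : ℝ} (hx : 0 < x) (hs : 1 < s) :
    ∫⁻ t in Ioi (0 : ℝ), ENNReal.ofReal ((x + t) ^ (-s)) =
      ENNReal.ofReal (x ^ (1 - s) / (s - 1)) := by
  have h1 : ∫⁻ t in Ioi (0 : ℝ), ENNReal.ofReal ((x + t) ^ (-s))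
      = ∫⁻ y in Ioi x, ENNReal.ofReal (y ^ (-s)) := by
    have hcv := lintegral_image_eq_lintegral_abs_deriv_mul (s := Ioi (0 : ℝ))
      (f := fun y : ℝ ↦ x + y) (f' := fun y ↦ 1) measurableSet_Ioi
      (fun y _ ↦ ((hasDerivAt_id y).const_add x).hasDerivWithinAt)
      (fun y _ z _ h ↦ by simpa using h) (fun y ↦ ENNReal.ofReal (y ^ (-s)))
    simpa using hcv.symm
  rw [h1, ← ofReal_integral_eq_lintegral_ofReal (integrableOn_Ioi_rpow_of_lt (by linarith) hx),
    integral_Ioi_rpow_of_lt (by linarith) hx]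
  · congr 1
    rw [show -s + 1 = -(s - 1) by ring, neg_div_neg_eq, neg_sub]
  · filter_upwards [ae_restrict_mem measurableSet_Ioi] with y hy
    exact rpow_nonneg (hx.trans hy).le _

/-- The classical estimate `∫ |1 - r e^{iθ}|^{-s} dθ = O((1 - r)^{1 - s})` for `s > 1`. -/
theorem lintegral_norm_one_sub_mul_exp_rpow_le {r s : ℝ} (hr : r ∈ Ico (0 : ℝ) 1) (hs : 1 < s) :
    ∫⁻ θ in Ioc (0 : ℝ) (2 * π),
      ENNReal.ofReal (‖1 - r * Complex.exp (θ * Complex.I)‖ ^ (-s)) ≤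
      ENNReal.ofReal (2 * (1 + π) ^ s / (s - 1) * (1 - r) ^ (1 - s)) := by
  have hx : 0 < 1 - r := by linarith [hr.2]
  set g : ℝ → ℝ≥0∞ := (Ici 0).indicator fun t ↦ ENNReal.ofReal ((1 - r + t) ^ (-s)) with hg
  have hgm : Measurable g := Measurable.indicator (by fun_prop) measurableSet_Ici
  have hgi : ∫⁻ t, g t = ENNReal.ofReal ((1 - r) ^ (1 - s) / (s - 1)) := by
    rw [hg, lintegral_indicator measurableSet_Ici, ← restrict_Ioi_eq_restrict_Ici,
      lintegral_add_rpow_le hx hs]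
  have hpt : ∀ θ ∈ Ioc (0 : ℝ) (2 * π),
      ENNReal.ofReal (‖1 - r * Complex.exp (θ * Complex.I)‖ ^ (-s)) ≤
        ENNReal.ofReal ((1 + π) ^ s) * (g θ + g (2 * π - θ)) := by
    intro θ hθ
    have key : ∀ t, 0 ≤ t → t ≤ π → (θ = t ∨ θ = 2 * π - t) →
        ENNReal.ofReal (‖1 - r * Complex.exp (θ * Complex.I)‖ ^ (-s)) ≤
          ENNReal.ofReal ((1 + π) ^ s) * g t := by
      intro t ht0 ht h
      rw [hg, indicator_of_mem (mem_Ici.2 ht0), ← ENNReal.ofReal_mul (by positivity)]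
      apply ENNReal.ofReal_le_ofReal
      have h1 := add_le_mul_norm_one_sub_mul_exp hr ht0 ht h
      have h2 : (1 - r + t) / (1 + π) ≤ ‖1 - r * Complex.exp (θ * Complex.I)‖ := by
        rwa [div_le_iff₀' (by positivity)]
      refine (rpow_le_rpow_of_nonpos (by positivity) h2 (by linarith)).trans_eq ?_
      rw [div_rpow (by positivity) (by positivity), rpow_neg (by positivity : 0 ≤ 1 + π),
        div_inv_eq_mul, mul_comm]
    rcases le_total θ π with h | h
    · exact (key θ hθ.1.le h (Or.inl rfl)).trans (by gcongr; exact le_self_add)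
    · refine (key (2 * π - θ) (by linarith [hθ.2]) (by linarith) (Or.inr (by ring))).trans ?_
      gcongr
      exact le_add_self
  calc _ ≤ ∫⁻ θ in Ioc (0 : ℝ) (2 * π), ENNReal.ofReal ((1 + π) ^ s) * (g θ + g (2 * π - θ)) :=
        setLIntegral_mono' measurableSet_Ioc hpt
    _ ≤ ∫⁻ θ, ENNReal.ofReal ((1 + π) ^ s) * (g θ + g (2 * π - θ)) :=
        setLIntegral_le_lintegral _ _
    _ = ENNReal.ofReal ((1 + π) ^ s) * ((∫⁻ t, g t) + ∫⁻ t, g t) := by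
        rw [lintegral_const_mul' _ _ ENNReal.ofReal_ne_top, lintegral_add_left hgm,
          lintegral_sub_left_eq_self g (2 * π)]
    _ = _ := by
        have : 0 < s - 1 := by linarith
        rw [hgi, ← ENNReal.ofReal_add (by positivity) (by positivity),
          ← ENNReal.ofReal_mul (by positivity)]
        congr 1
        ring

end Kernel

/-! ### Test functions with a logarithmic factor -/

section TestFunction

open Real

/-- The function `(1 - z)^{-c} (A - log (1 - z))^{-ε}`, with principal branches. The powers
are written through `exp`, so that the modulus is read off from real parts. -/
noncomputable def logTestFunction (c ε A : ℝ) (z : ℂ) : ℂ :=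
  Complex.exp (-c * Complex.log (1 - z) - ε * Complex.log (A - Complex.log (1 - z)))

variable {c ε A : ℝ}

theorem one_sub_mem_slitPlane {z : ℂ} (hz : ‖z‖ < 1) : 1 - z ∈ Complex.slitPlane := by
  left
  have := (Complex.re_le_norm z).trans_lt hz
  simp only [Complex.sub_re, Complex.one_re]
  linarith

theorem norm_one_sub_le_two {z : ℂ} (hz : ‖z‖ < 1) : ‖1 - z‖ ≤ 2 := by
  have := norm_sub_le (1 : ℂ) z
  rw [norm_one] at this
  linarith

theorem sub_log_norm_pos (hA : log 2 < A) {z : ℂ} (hz : ‖z‖ < 1) : 0 < A - log ‖1 - z‖ := by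
  have h0 : 0 < ‖1 - z‖ := norm_pos_iff.2 (Complex.slitPlane_ne_zero (one_sub_mem_slitPlane hz))
  have := log_le_log h0 (norm_one_sub_le_two hz)
  linarith

theorem re_sub_log (z : ℂ) : ((A : ℂ) - Complex.log (1 - z)).re = A - log ‖1 - z‖ := by
  simp [Complex.log_re]

theorem norm_logTestFunction (hA : log 2 < A) {z : ℂ} (hz : ‖z‖ < 1) :
    ‖logTestFunction c ε A z‖ = ‖1 - z‖ ^ (-c) * ‖(A : ℂ) - Complex.log (1 - z)‖ ^ (-ε) := by
  have h0 : 0 < ‖1 - z‖ := norm_pos_iff.2 (Complex.slitPlane_ne_zero (one_sub_mem_slitPlane hz))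
  have h1 : 0 < ‖(A : ℂ) - Complex.log (1 - z)‖ :=
    ((sub_log_norm_pos hA hz).trans_eq (re_sub_log z).symm).trans_le (Complex.re_le_norm _)
  rw [logTestFunction, Complex.norm_exp, rpow_def_of_pos h0, rpow_def_of_pos h1, ← exp_add]
  congr 1
  rw [Complex.sub_re, ← Complex.ofReal_neg, Complex.re_ofReal_mul, Complex.re_ofReal_mul,
    Complex.log_re, Complex.log_re]
  ring

theorem analyticOnNhd_logTestFunction (hA : log 2 < A) :
    AnalyticOnNhd ℂ (logTestFunction c ε A) (Metric.ball 0 1) := by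
  intro z hz
  rw [mem_ball_zero_iff] at hz
  have h1 : AnalyticAt ℂ (fun z : ℂ ↦ Complex.log (1 - z)) z :=
    (analyticAt_const.sub analyticAt_id).clog (one_sub_mem_slitPlane hz)
  have h2 : AnalyticAt ℂ (fun z : ℂ ↦ Complex.log (A - Complex.log (1 - z))) z := by
    refine (analyticAt_const.sub h1).clog (Or.inl ?_)
    simp only [Pi.sub_apply, re_sub_log]
    exact sub_log_norm_pos hA hz
  exact ((analyticAt_const.mul h1).sub (analyticAt_const.mul h2)).cexp

/-- For large `A` the function `s^{-a} (A - log s)^{-ε}` is decreasing. -/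
theorem rpow_neg_mul_sub_log_rpow_neg_le {a x s : ℝ} (ha : 0 < a) (hε : 0 < ε) (hx : 0 < x)
    (hxs : x ≤ s) (hA : ε / a ≤ A - log s) :
    s ^ (-a) * (A - log s) ^ (-ε) ≤ x ^ (-a) * (A - log x) ^ (-ε) := by
  have hs : 0 < s := hx.trans_le hxs
  have hB : 0 < A - log s := (div_pos hε ha).trans_le hA
  have hlog : log x ≤ log s := log_le_log hx hxs
  have hBx : 0 < A - log x := by linarith
  rw [rpow_def_of_pos hs, rpow_def_of_pos hB, rpow_def_of_pos hx, rpow_def_of_pos hBx,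
    ← exp_add, ← exp_add, exp_le_exp]
  -- `log (B (x) / B (s)) ≤ (log s - log x) / B (s) ≤ (a / ε) (log s - log x)`
  have h1 : log (A - log x) - log (A - log s) ≤ (log s - log x) / (A - log s) := by
    rw [← log_div hBx.ne' hB.ne']
    refine (log_le_sub_one_of_pos (div_pos hBx hB)).trans_eq ?_
    field_simp
    ring
  have h2 : (log s - log x) / (A - log s) ≤ (log s - log x) / (ε / a) :=
    div_le_div_of_nonneg_left (by linarith) (div_pos hε ha) hA
  have h3 : ε * ((log s - log x) / (ε / a)) = a * (log s - log x) := by field_simp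
  have h4 := mul_le_mul_of_nonneg_left (h1.trans h2) hε.le
  rw [h3] at h4
  linarith

/-- The factor `|1 - z|^{-a}` of the power is spent, together with the logarithm, on a bound
depending on `r` only, so that the mean of the test function reduces to that of a pure power of `1 - z`. -/
theorem norm_logTestFunction_le {a r : ℝ} (ha : 0 < a) (hε : 0 < ε) (hA : log 2 + ε / a ≤ A)
    {z : ℂ} (hz : ‖z‖ ≤ r) (hr : r < 1) :
    ‖logTestFunction c ε A z‖ ≤
      (1 - r) ^ (-a) * (A - log (1 - r)) ^ (-ε) * ‖1 - z‖ ^ (-(c - a)) := by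
  have hz1 : ‖z‖ < 1 := hz.trans_lt hr
  have hA2 : log 2 < A := by linarith [div_pos hε ha]
  have h0 : 0 < ‖1 - z‖ := norm_pos_iff.2 (Complex.slitPlane_ne_zero (one_sub_mem_slitPlane hz1))
  have hB := sub_log_norm_pos hA2 hz1
  have hre : A - log ‖1 - z‖ ≤ ‖(A : ℂ) - Complex.log (1 - z)‖ :=
    (re_sub_log z).symm.trans_le (Complex.re_le_norm _)
  have hx : 1 - r ≤ ‖1 - z‖ := by
    have := norm_sub_norm_le (1 : ℂ) z
    rw [norm_one] at this
    linarith
  have hlog2 := log_le_log h0 (norm_one_sub_le_two hz1)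
  have h1 := rpow_neg_mul_sub_log_rpow_neg_le ha hε (by linarith) hx (A := A) (by linarith)
  rw [norm_logTestFunction hA2 hz1]
  calc _ ≤ ‖1 - z‖ ^ (-c) * (A - log ‖1 - z‖) ^ (-ε) := by
        gcongr ?_ * ?_
        exact rpow_le_rpow_of_nonpos hB hre (by linarith)
    _ = (‖1 - z‖ ^ (-a) * (A - log ‖1 - z‖) ^ (-ε)) * ‖1 - z‖ ^ (-(c - a)) := by
        rw [show -c = -a + -(c - a) by ring, rpow_add h0]
        ring
    _ ≤ _ := by gcongr

theorem le_norm_logTestFunction {r θ : ℝ} (hc : 0 ≤ c) (hε : 0 ≤ ε) (hA : log 2 < A)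
    (hr : r ∈ Ico (0 : ℝ) 1) (hθ0 : 0 ≤ θ) (hθ : θ ≤ 1 - r) :
    2 ^ (-c) * ((1 - r) ^ (-c) * (A + π - log (1 - r)) ^ (-ε)) ≤
      ‖logTestFunction c ε A (r * Complex.exp (θ * Complex.I))‖ := by
  set z : ℂ := r * Complex.exp (θ * Complex.I) with hz
  have hzr : ‖z‖ = r := by
    rw [hz, norm_mul, Complex.norm_exp_ofReal_mul_I, mul_one, Complex.norm_real,
      norm_of_nonneg hr.1]
  have hz1 : ‖z‖ < 1 := hzr.trans_lt hr.2
  have hx : 0 < 1 - r := by linarith [hr.2]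
  have h0 : 0 < ‖1 - z‖ := norm_pos_iff.2 (Complex.slitPlane_ne_zero (one_sub_mem_slitPlane hz1))
  have hup : ‖1 - z‖ ≤ 2 * (1 - r) := by
    have h1 : 1 - z = ((1 - r : ℝ) : ℂ) - r * (Complex.exp (Complex.I * θ) - 1) := by
      rw [hz, mul_comm Complex.I]; push_cast; ring
    rw [h1]
    refine (norm_sub_le _ _).trans ?_
    rw [Complex.norm_real, norm_of_nonneg hx.le, norm_mul, Complex.norm_real, norm_of_nonneg hr.1]
    have h2 := norm_exp_I_mul_ofReal_sub_one_le (x := θ)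
    rw [norm_of_nonneg hθ0] at h2
    nlinarith [norm_nonneg (Complex.exp (Complex.I * θ) - 1), hr.1, hr.2]
  have hlow : 1 - r ≤ ‖1 - z‖ := one_sub_le_norm_one_sub_mul_exp hr.1 θ
  have hlogle := log_le_log hx hlow
  have hD : ‖(A : ℂ) - Complex.log (1 - z)‖ ≤ A + π - log (1 - r) := by
    refine (Complex.norm_le_abs_re_add_abs_im _).trans ?_
    rw [re_sub_log, abs_of_pos (sub_log_norm_pos hA hz1), Complex.sub_im, Complex.ofReal_im,
      zero_sub, abs_neg, Complex.log_im]
    linarith [Complex.abs_arg_le_pi (1 - z)]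
  have hpos : 0 < ‖(A : ℂ) - Complex.log (1 - z)‖ :=
    ((sub_log_norm_pos hA hz1).trans_eq (re_sub_log z).symm).trans_le (Complex.re_le_norm _)
  rw [norm_logTestFunction hA hz1, ← mul_assoc, ← mul_rpow (by norm_num) hx.le]
  refine mul_le_mul ?_ ?_ (rpow_nonneg (hpos.le.trans hD) _) (by positivity)
  · exact rpow_le_rpow_of_nonpos h0 hup (by linarith)
  · exact rpow_le_rpow_of_nonpos hpos hD (by linarith)

/-- The test function has means of order `p` of size at most
`(1 - r)^{1/p - c} (log (1 / (1 - r)))^{-ε}`. -/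
theorem exists_integralMean_logTestFunction_le {p : ℝ≥0∞} (hp : p ≠ 0) (hp' : p ≠ ∞) {α : ℝ}
    (hα : 0 < α) (hε : 0 < ε) (hA : log 2 + ε / (α / 2) ≤ A) :
    ∃ C : ℝ, 0 ≤ C ∧ ∀ r ∈ Ico (0 : ℝ) 1,
      integralMean p r (logTestFunction (α + (1 / p).toReal) ε A) ≤
        ENNReal.ofReal (C * ((1 - r) ^ (-α) * (A - log (1 - r)) ^ (-ε))) := by
  have hp0 : 0 < p.toReal := ENNReal.toReal_pos hp hp'
  rw [ENNReal.toReal_div, ENNReal.toReal_one]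
  set P := p.toReal with hP
  set s := α * P / 2 + 1 with hs
  have hs1 : 1 < s := by rw [hs]; linarith [mul_pos hα hp0]
  set K := 2 * (1 + π) ^ s / (s - 1) with hK
  have hs0 : 0 < s - 1 := by linarith
  have hK0 : 0 < K := by positivity
  refine ⟨(1 / (2 * π) * K) ^ (1 / P), by positivity, fun r hr ↦ ?_⟩
  have hx : 0 < 1 - r := by linarith [hr.2]
  have hA2 : 0 < A - log (1 - r) := by
    have h1 := log_nonpos hx.le (by linarith [hr.1])
    have h2 := log_pos (by norm_num : (1 : ℝ) < 2)
    have h3 := div_pos hε (half_pos hα)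
    linarith
  set W := (1 - r) ^ (-(α / 2)) * (A - log (1 - r)) ^ (-ε) with hW
  have hW0 : 0 < W := by positivity
  rw [integralMean, if_neg hp']
  have hpt : ∀ θ : ℝ,
      ‖logTestFunction (α + 1 / P) ε A (r * Complex.exp (θ * Complex.I))‖ₑ ^ P ≤
      ENNReal.ofReal (W ^ P) *
        ENNReal.ofReal (‖1 - r * Complex.exp (θ * Complex.I)‖ ^ (-s)) := by
    intro θ
    have hz : ‖r * Complex.exp (θ * Complex.I)‖ ≤ r := by
      rw [norm_mul, Complex.norm_exp_ofReal_mul_I, mul_one, Complex.norm_real,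
        norm_of_nonneg hr.1]
    have h1 := norm_logTestFunction_le (c := α + 1 / P) (half_pos hα) hε hA hz hr.2
    rw [← ofReal_norm, ENNReal.ofReal_rpow_of_nonneg (norm_nonneg _) hp0.le,
      ← ENNReal.ofReal_mul (by positivity)]
    apply ENNReal.ofReal_le_ofReal
    refine (rpow_le_rpow (norm_nonneg _) h1 hp0.le).trans_eq ?_
    rw [mul_rpow hW0.le (by positivity), ← rpow_mul (norm_nonneg _)]
    congr 2
    rw [hs]
    field_simp
    ring
  calc _ ≤ (ENNReal.ofReal (1 / (2 * π)) * ∫⁻ θ in Ioc (0 : ℝ) (2 * π), ENNReal.ofReal (W ^ P) *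
        ENNReal.ofReal (‖1 - r * Complex.exp (θ * Complex.I)‖ ^ (-s))) ^ (1 / P) := by
        gcongr
        exact hpt _
    _ ≤ (ENNReal.ofReal (1 / (2 * π)) * (ENNReal.ofReal (W ^ P) *
        ENNReal.ofReal (K * (1 - r) ^ (1 - s)))) ^ (1 / P) := by
        rw [lintegral_const_mul' _ _ ENNReal.ofReal_ne_top]
        gcongr
        exact lintegral_norm_one_sub_mul_exp_rpow_le hr hs1
    _ = ENNReal.ofReal ((1 / (2 * π) * K) ^ (1 / P) *
          (W * (1 - r) ^ (-(α / 2)))) := by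
        rw [← ENNReal.ofReal_mul (by positivity), ← ENNReal.ofReal_mul (by positivity),
          ENNReal.ofReal_rpow_of_nonneg (by positivity) (by positivity)]
        congr 1
        rw [show 1 / (2 * π) * (W ^ P * (K * (1 - r) ^ (1 - s)))
          = (1 / (2 * π) * K) * (W ^ P * (1 - r) ^ (1 - s)) by ring,
          mul_rpow (x := 1 / (2 * π) * K) (by positivity) (by positivity),
          mul_rpow (x := W ^ P) (by positivity) (by positivity), one_div P,
          rpow_rpow_inv hW0.le hp0.ne', ← rpow_mul hx.le]
        congr 3
        rw [hs]
        field_simp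
        ring
    _ = _ := by
        congr 2
        rw [hW, mul_right_comm, ← rpow_add hx]
        congr 2
        ring

/-- On an arc of length `1 - r` about the point `r` the test function is of maximal size. -/
theorem exists_le_integralMean_logTestFunction {u : ℝ≥0∞} (hu : u ≠ 0) (hc : 0 ≤ c) (hε : 0 ≤ ε)
    (hA : log 2 < A) :
    ∃ C : ℝ, 0 < C ∧ ∀ r ∈ Ico (0 : ℝ) 1,
      ENNReal.ofReal (C * ((1 - r) ^ ((1 / u).toReal - c) * (A + π - log (1 - r)) ^ (-ε))) ≤
        integralMean u r (logTestFunction c ε A) := by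
  rcases eq_or_ne u ∞ with rfl | hu'
  · refine ⟨2 ^ (-c), by positivity, fun r hr ↦ ?_⟩
    have h1 := le_norm_logTestFunction hc hε hA hr le_rfl (by linarith [hr.2])
    rw [ENNReal.div_top, ENNReal.toReal_zero, zero_sub]
    refine (ENNReal.ofReal_le_ofReal h1).trans ?_
    rw [ofReal_norm, integralMean, if_pos rfl]
    exact le_iSup₂ (f := fun (θ : ℝ) (_ : θ ∈ Ico (0 : ℝ) (2 * π)) ↦
      ‖logTestFunction c ε A (r * Complex.exp (θ * Complex.I))‖ₑ) 0 ⟨le_rfl, by positivity⟩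
  have hu0 : 0 < u.toReal := ENNReal.toReal_pos hu hu'
  rw [ENNReal.toReal_div, ENNReal.toReal_one]
  set U := u.toReal with hU
  refine ⟨2 ^ (-c) * (1 / (2 * π)) ^ (1 / U), by positivity, fun r hr ↦ ?_⟩
  have hx : 0 < 1 - r := by linarith [hr.2]
  have hD : 0 < A + π - log (1 - r) := by
    have h1 := log_nonpos hx.le (by linarith [hr.1])
    have h2 := log_pos (by norm_num : (1 : ℝ) < 2)
    linarith [pi_pos]
  set W := 2 ^ (-c) * ((1 - r) ^ (-c) * (A + π - log (1 - r)) ^ (-ε)) with hW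
  have hW0 : 0 < W := by positivity
  rw [integralMean, if_neg hu']
  have hsub : Ioc 0 (1 - r) ⊆ Ioc 0 (2 * π) :=
    Ioc_subset_Ioc_right (by linarith [hr.1, pi_gt_three])
  calc _ = (ENNReal.ofReal (1 / (2 * π)) *
          ∫⁻ θ in Ioc (0 : ℝ) (1 - r), ENNReal.ofReal (W ^ U)) ^ (1 / U) := by
        rw [setLIntegral_const, Real.volume_Ioc, sub_zero, ← ENNReal.ofReal_mul (by positivity),
          ← ENNReal.ofReal_mul (by positivity),
          ENNReal.ofReal_rpow_of_nonneg (by positivity) (by positivity)]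
        congr 1
        rw [mul_rpow (by positivity) (by positivity), mul_rpow (by positivity) hx.le, one_div U,
          rpow_rpow_inv hW0.le hu0.ne', hW,
          show U⁻¹ - c = U⁻¹ + -c by ring, rpow_add hx]
        ring
    _ ≤ (ENNReal.ofReal (1 / (2 * π)) * ∫⁻ θ in Ioc (0 : ℝ) (1 - r),
          ‖logTestFunction c ε A (r * Complex.exp (θ * Complex.I))‖ₑ ^ U) ^ (1 / U) := by
        refine ENNReal.rpow_le_rpow (mul_le_mul_right
          (setLIntegral_mono' measurableSet_Ioc fun θ hθ ↦ ?_) _) (by positivity)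
        rw [← ofReal_norm, ENNReal.ofReal_rpow_of_nonneg (norm_nonneg _) hu0.le]
        apply ENNReal.ofReal_le_ofReal
        gcongr
        exact le_norm_logTestFunction hc hε hA hr hθ.1.le hθ.2
    _ ≤ _ := by
        exact ENNReal.rpow_le_rpow (mul_le_mul_right (lintegral_mono_set hsub) _) (by positivity)

/-- On the critical line the inclusion fails if the second exponent drops below `q`. -/
theorem not_subset_of_lt {p q u v : ℝ≥0∞} {α β : ℝ} (hp : p ≠ 0) (hp' : p ≠ ∞) (hu : u ≠ 0)
    (hv : v ≠ 0) (hα : 0 < α) (hβ : 0 < β)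
    (h : α + (1 / p).toReal = β + (1 / u).toReal) (hvq : v < q) :
    ¬ mixedNormSpace p q α ⊆ mixedNormSpace u v β := by
  have hv' : v ≠ ∞ := hvq.ne_top
  have hv0 : 0 < v.toReal := ENNReal.toReal_pos hv hv'
  -- `ε v = 1 < ε q`: the logarithmic integral converges with exponent `ε q`, diverges with `ε v`
  obtain ⟨ε, hε⟩ : ∃ ε, ε = 1 / v.toReal := ⟨_, rfl⟩
  have hε0 : 0 < ε := hε ▸ by positivity
  obtain ⟨A, hA⟩ : ∃ A, A = log 2 + ε / (α / 2) + 1 := ⟨_, rfl⟩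
  have hεα : 0 < ε / (α / 2) := by positivity
  have hlog2 : 0 < log 2 := log_pos (by norm_num)
  have hA2 : log 2 < A := by linarith
  have hc0 : 0 ≤ α + (1 / p).toReal := by positivity
  obtain ⟨C, hC0, hC⟩ := exists_integralMean_logTestFunction_le (A := A) hp hp' hα hε0
    (by linarith)
  obtain ⟨D, hD0, hD⟩ := exists_le_integralMean_logTestFunction hu hc0 hε0.le hA2
  set F := logTestFunction (α + (1 / p).toReal) ε A with hF
  have hB : ∀ r ∈ Ico (0 : ℝ) 1, 1 ≤ A - log (1 - r) := fun r hr ↦ by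
    have := log_nonpos (by linarith [hr.2] : 0 ≤ 1 - r) (by linarith [hr.1])
    linarith
  intro hsub
  have hmem : F ∈ mixedNormSpace p q α := by
    refine ⟨analyticOnNhd_logTestFunction hA2, ?_⟩
    rcases eq_or_ne q ∞ with rfl | hq'
    · refine lt_of_le_of_lt (mixedNorm_top_le fun r hr ↦ ?_) (ENNReal.ofReal_lt_top (r := C))
      have hx : 0 < 1 - r := by linarith [hr.2]
      refine (mul_le_mul_right (hC r hr) _).trans ?_
      rw [← ENNReal.ofReal_mul (by positivity)]
      apply ENNReal.ofReal_le_ofReal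
      have h1 := rpow_le_one_of_one_le_of_nonpos (hB r hr) (by linarith : -ε ≤ 0)
      calc (1 - r) ^ α * (C * ((1 - r) ^ (-α) * (A - log (1 - r)) ^ (-ε)))
          = C * ((1 - r) ^ (α + -α) * (A - log (1 - r)) ^ (-ε)) := by rw [rpow_add hx]; ring
        _ ≤ C := by
          rw [add_neg_cancel, rpow_zero, one_mul]
          exact mul_le_of_le_one_right hC0 h1
    · have hq : q ≠ 0 := (pos_of_gt hvq).ne'
      have hq0 : 0 < q.toReal := ENNReal.toReal_pos hq hq'
      have hεq : 1 < ε * q.toReal := by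
        rw [hε, one_div_mul_eq_div, one_lt_div hv0]
        exact (ENNReal.toReal_lt_toReal hv' hq').2 hvq
      rw [mixedNorm_lt_top_iff hq hq' hα]
      refine lt_of_le_of_lt (b := ∫⁻ r in Ioo (0 : ℝ) 1, ENNReal.ofReal (C ^ q.toReal) *
        ENNReal.ofReal ((1 - r)⁻¹ * (A - log (1 - r)) ^ (-(ε * q.toReal)))) ?_ ?_
      · refine setLIntegral_mono' measurableSet_Ioo fun r hr ↦ ?_
        have hr' : r ∈ Ico (0 : ℝ) 1 := ⟨hr.1.le, hr.2⟩
        have hx : 0 < 1 - r := by linarith [hr.2]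
        have hB' : 0 < A - log (1 - r) := by linarith [hB r hr']
        refine (mul_le_mul_right (ENNReal.rpow_le_rpow (hC r hr') hq0.le) _).trans (le_of_eq ?_)
        rw [ENNReal.ofReal_rpow_of_nonneg (by positivity) hq0.le,
          ← ENNReal.ofReal_mul (by positivity), ← ENNReal.ofReal_mul (by positivity)]
        congr 1
        rw [mul_rpow hC0 (by positivity), mul_rpow (by positivity) (by positivity),
          ← rpow_mul hx.le, ← rpow_mul hB'.le, rpow_sub_one hx.ne', neg_mul, rpow_neg hx.le,
          neg_mul]
        have := (rpow_pos_of_pos hx (α * q.toReal)).ne'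
        field_simp
      · rw [lintegral_const_mul' _ _ ENNReal.ofReal_ne_top]
        exact ENNReal.mul_lt_top ENNReal.ofReal_lt_top
          (lintegral_inv_one_sub_mul_log_rpow_lt_top (by linarith) hεq)
  have hfin := (hsub hmem).2
  rw [mixedNorm_lt_top_iff hv hv' hβ] at hfin
  refine hfin.not_ge ?_
  have htop : ∫⁻ r in Ioo (0 : ℝ) 1, ENNReal.ofReal (D ^ v.toReal) *
      ENNReal.ofReal ((1 - r)⁻¹ * (A + π - log (1 - r))⁻¹) = ∞ := by
    rw [lintegral_const_mul' _ _ ENNReal.ofReal_ne_top,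
      lintegral_inv_one_sub_mul_log_inv (by linarith [pi_pos])]
    exact ENNReal.mul_top (by simpa using rpow_pos_of_pos hD0 _)
  rw [← htop]
  refine setLIntegral_mono' measurableSet_Ioo fun r hr ↦ ?_
  have hr' : r ∈ Ico (0 : ℝ) 1 := ⟨hr.1.le, hr.2⟩
  have hx : 0 < 1 - r := by linarith [hr.2]
  have hB' : 0 < A + π - log (1 - r) := by linarith [hB r hr', pi_pos]
  refine le_trans (le_of_eq ?_) (mul_le_mul_right (ENNReal.rpow_le_rpow (hD r hr') hv0.le) _)
  rw [ENNReal.ofReal_rpow_of_nonneg (by positivity) hv0.le,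
    ← ENNReal.ofReal_mul (by positivity), ← ENNReal.ofReal_mul (by positivity)]
  congr 1
  rw [mul_rpow hD0.le (by positivity), mul_rpow (by positivity) (by positivity),
    ← rpow_mul hx.le, ← rpow_mul hB'.le, rpow_sub_one hx.ne',
    show (1 / u).toReal - (α + (1 / p).toReal) = -β by linarith,
    show -ε * v.toReal = -1 by rw [hε]; field_simp, rpow_neg_one, neg_mul, rpow_neg hx.le]
  have := (rpow_pos_of_pos hx (β * v.toReal)).ne'
  field_simp

end TestFunction

/-! ### The inclusion criterion -/

theorem theorem2 (p q u v : ℝ≥0∞) (α β : ℝ)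
    (hp : 0 < p) (hq : 0 < q) (hu : 0 < u) (hv : 0 < v) (hα : 0 < α) (hβ : 0 < β)
    (hpu : p < u) :
    mixedNormSpace p q α ⊆ mixedNormSpace u v β ↔
      (α + (1 / p).toReal < β + (1 / u).toReal ∨
        (α + (1 / p).toReal = β + (1 / u).toReal ∧ q ≤ v)) := by
  have hp' : p ≠ ∞ := hpu.ne_top
  have hinv : (1 / u).toReal < (1 / p).toReal := by
    rw [ENNReal.toReal_lt_toReal (by simpa using hu.ne') (by simpa using hp.ne'), one_div, one_div]
    exact ENNReal.inv_lt_inv.2 hpu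
  constructor
  · intro hsub
    by_contra! hcon
    obtain ⟨hle, hlt⟩ := hcon
    rcases hle.eq_or_lt with heq | hgt
    · exact not_subset_of_lt hp.ne' hp' hu.ne' hv.ne' hα hβ heq.symm (hlt heq.symm) hsub
    · -- enlarge the target to a space on the critical line with a second exponent below `q`
      have hw : min q 1 / 2 < q :=
        (ENNReal.half_lt_self (by simpa using hq.ne') (by simp)).trans_le (min_le_left _ _)
      have hw0 : min q 1 / 2 ≠ 0 := by simpa using hq.ne'
      refine not_subset_of_lt (β := α + (1 / p).toReal - (1 / u).toReal) hp.ne' hp' hu.ne' hw0 hα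
        (by linarith) (by ring) hw (hsub.trans fun f hf ↦ ⟨hf.1, ?_⟩)
      exact mixedNorm_lt_top_of_lt hw0 (by linarith) (by linarith)
        (mixedNorm_top_lt_top hu.ne' hv.ne' hβ hf.1 hf.2)
  · rintro (hlt | ⟨heq, hqv⟩) f ⟨hf, hfin⟩
    · refine ⟨hf, mixedNorm_lt_top_of_lt (α := α + (1 / p).toReal - (1 / u).toReal) hv.ne' hβ
        (by linarith) ?_⟩
      exact mixedNorm_lt_top_of_exponent_lt hp.ne' hpu ENNReal.top_ne_zero hα (by linarith)
        (by ring) hf (mixedNorm_top_lt_top hp.ne' hq.ne' hα hf hfin)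
    · exact ⟨hf, mixedNorm_lt_top_of_le hu.ne' hq.ne' hβ hqv hf
        (mixedNorm_lt_top_of_exponent_lt hp.ne' hpu hq.ne' hα hβ heq hf hfin)⟩
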